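/- **Setting.** *Syntax.* Fix infinite sets of regular variables $x$, confined variables $i$ (also called level variables) and constants $c$. Sorts are $s ::= \mathsf{Type}\mid\mathsf{Kind}$; levels are $l ::= i \mid 0 \mid \mathsf S\,l \mid l\sqcup l'$; terms and types are $$A,B,t,u ::= x\mid c\mid s\mid (x:A)\to B\mid x.t\mid t\,u\mid (i:A)\to B\mid i.t\mid t\,l .$$ A context $\Gamma$ is a sequence of entries $x:A$ or $i:A$. A local signature $\Phi$ is a finite sequence of entries $c:A$ or $c:A:=t$ with distinct names. *The theory $\mathbb{UPP}$.* It has the constant $\mathsf{Lvl}:\mathsf{Type}$, the confined constants $0:()\to\mathsf{Lvl}$, $\mathsf S:(i:\mathsf{Lvl})\to\mathsf{Lvl}$ and $\sqcup:(i,i':\mathsf{Lvl})\to\mathsf{Lvl}$, and the constants - $\mathsf{Ty}:(l:\mathsf{Lvl})\to\mathsf{Type}$, $\ \mathsf{Tm}:(l:\mathsf{Lvl})\to\mathsf{Ty}\,l\to\mathsf{Type}$, $\ \mathsf U:(l:\mathsf{Lvl})\to\mathsf{Ty}\,(\mathsf S\,l)$, - $\Pi:(l\,l':\mathsf{Lvl})\to(A:\mathsf{Ty}\,l)\to(B:\mathsf{Tm}\,l\,A\to\mathsf{Ty}\,l')\to\mathsf{Ty}\,(l\sqcup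 l')$, - $\lambda:(l\,l':\mathsf{Lvl})\to(A:\mathsf{Ty}\,l)\to(B:\mathsf{Tm}\,l\,A\to\mathsf{Ty}\,l')\to((x:\mathsf{Tm}\,l\,A)\to\mathsf{Tm}\,l'\,(B\,x))\to\mathsf{Tm}\,(l\sqcup l')\,(\Pi\,l\,l'\,A\,B)$, - $@:(l\,l':\mathsf{Lvl})\to(A:\mathsf{Ty}\,l)\to(B:\mathsf{Tm}\,l\,A\to\mathsf{Ty}\,l')\to(t:\mathsf{Tm}\,(l\sqcup l')\,(\Pi\,l\,l'\,A\,B))\to(u:\mathsf{Tm}\,l\,A)\to\mathsf{Tm}\,l'\,(B\,u)$. Its rewrite rules are $\mathsf{Tm}\,l'\,(\mathsf U\,l)\longrightarrow\mathsf{Ty}\,l$ and $@\,l\,l'\,A\,B\,(\lambda\,l''\,l'''\,A'\,B'\,t)\,u\longrightarrow t\,u$. The relation $\simeq$ is the congruence generated by the equations on levels $$i_1\sqcup(i_2\sqcup i_3)\simeq(i_1\sqcup i_2)\sqcup i_3,\quad i_1\sqcup i_2\simeq i_2\sqcup i_1,\quad \mathsf S(i_1\sqcup i_2)\simeq\mathsf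 S\,i_1\sqcup\mathsf S\,i_2,$$ $$i\sqcup\mathsf S\,i\simeq\mathsf S\,i,\quad i\sqcup 0\simeq i,\quad i\sqcup i\simeq i .$$ Given a local signature, $\longrightarrow$ is the closure by context of these rewrite rules, of $(x.t)u\longrightarrow t[x\mapsto u]$, of $(i.t)l\longrightarrow t[i\mapsto l]$ and of the unfolding $c\longrightarrow t$ of each definition $c:A:=t$; $\equiv$ is the equivalence relation generated by $\longrightarrow$ and $\simeq$. *Typing.* $\Gamma\vdash$, $\Gamma\vdash t:A$ and $\Gamma\vdash l:A$ are the least relations satisfying the following (for $\mathbb{UPP}$ extended with the local signature). The empty context is well-formed, and $\Gamma,x:A$ and $\Gamma,i:A$ are if $\Gamma\vdash A:\mathsf{Type}$. If $\Gamma\vdash$, then $\Gamma\vdash\mathsf{Type}:\mathsf{Kind}$, every variable and every constant has its declared type, and $\Gamma\vdash0:\mathsf{Lvl}$; $\mathsf S$ and $\sqcup$ applied to levels of type $\mathsf{Lvl}$ have type $\mathsf{Lvl}$. If $\Gamma\vdash t:A$, $\Gamma\vdash B:s$ and $A\equiv B$, then $\Gamma\vdash t:B$ (likewise for a level $l$,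 with $s=\mathsf{Type}$). If $\Gamma\vdash A:\mathsf{Type}$ and $\Gamma,x:A\vdash B:s$, then $\Gamma\vdash(x:A)\to B:s$, and if also $\Gamma,x:A\vdash t:B$, then $\Gamma\vdash x.t:(x:A)\to B$. If $\Gamma\vdash t:(x:A)\to B$ and $\Gamma\vdash u:A$, then $\Gamma\vdash t\,u:B[x\mapsto u]$. The last two clauses hold in the same way with a confined variable $i$ instead of $x$, and a level $l:A$ instead of $u$. A local signature is *well-formed in $\mathbb{UPP}$* if each entry is valid in $\mathbb{UPP}$ extended with the preceding entries: $c:A$ is valid if $()\vdash A:s$ for some sort $s$, and $c:A:=t$ is valid if $()\vdash t:A$. *Schematic terms* are the terms without confined abstractions $i.t$ and confined function types $(i:A)\to B$ in which the only levels are level variables, occurring as arguments of constant applications $c\,i_1\dots i_k$. *Constraints.* A problem $\mathcal C$ is a set of equations $l\doteq l'$ between levels. A substitution $\theta$ of levels for level variables is a *unifier* of $\mathcal C$ if $l[\theta]\simeq l'[\theta]$ for all $l\doteq l'$ in $\mathcal C$. *The elaborator*, over a local signature $\Phi'$. Write $t\longrightarrow^{\mathrm{wh}}u$ if $t\longrightarrow^*u$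 and, whenever $u\longrightarrow^*u'\,a_1\dots a_k$ with $k\ge0$ and each $a_j$ a term or a level, $u'$ matches no left-hand side of a rewrite rule (including the two $\beta$-rules and the unfolding of definitions). The following judgments are inductively defined. - $A\equiv B\downarrow\mathcal C$ if $A\longrightarrow^{\mathrm{wh}}A'$, $B\longrightarrow^{\mathrm{wh}}B'$ and $A'\equiv_{\mathrm{whnf}}B'\downarrow\mathcal C$. - $t\equiv_{\mathrm{whnf}}t\downarrow\emptyset$ for $t$ a variable, constant or sort; $x.t\equiv_{\mathrm{whnf}}x.t'\downarrow\mathcal C$ if $t\equiv t'\downarrow\mathcal C$; $(x:A)\to B\equiv_{\mathrm{whnf}}(x:A')\to B'\downarrow\mathcal C_1\cup\mathcal C_2$ if $A\equiv A'\downarrow\mathcal C_1$ and $B\equiv B'\downarrow\mathcal C_2$; $t\,u\equiv_{\mathrm{whnf}}t'\,u'\downarrow\mathcal C_1\cup\mathcal C_2$ if $t\equiv_{\mathrm{whnf}}t'\downarrow\mathcal C_1$ and $u\equiv u'\downarrow\mathcal C_2$; $t\,l\equiv_{\mathrm{whnf}}t'\,l'\downarrow\mathcal C\cup\{l\doteq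 l'\}$ if $t\equiv_{\mathrm{whnf}}t'\downarrow\mathcal C$. - Checking: $\Gamma\uparrow\mathcal D\vdash t\Leftarrow B\downarrow\mathcal C_1\cup\mathcal C_2$ if $\Gamma\uparrow\mathcal D\vdash t\Rightarrow A\downarrow\mathcal C_1$ and $A\equiv B\downarrow\mathcal C_2$; $\ \Gamma\uparrow\mathcal D\vdash x.t\Leftarrow T\downarrow\mathcal C$ if $T\longrightarrow^{\mathrm{wh}}(x:A)\to B$ and $\Gamma,x:A\uparrow\mathcal D\vdash t\Leftarrow B\downarrow\mathcal C$. - Inference: $\Gamma\uparrow\mathcal D\vdash x\Rightarrow A\downarrow\emptyset$ if $x:A\in\Gamma$; $\ \Gamma\uparrow\mathcal D\vdash c\,i_1\dots i_k\Rightarrow B[\vec j\mapsto\vec i]\downarrow\emptyset$ if $c$ has type $(j_1\dots j_k:\mathsf{Lvl})\to B$ in $\mathbb{UPP}$ or $\Phi'$; $\ \Gamma\uparrow\mathcal D\vdash\mathsf{Type}\Rightarrow\mathsf{Kind}\downarrow\emptyset$; $\ \Gamma\uparrow\mathcal D\vdash(x:A)\to B\Rightarrow s\downarrow\mathcal C_1\cup\mathcal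 C_2$ if $\Gamma\uparrow\mathcal D\vdash A\Leftarrow\mathsf{Type}\downarrow\mathcal C_1$, $\Gamma,x:A\uparrow\mathcal D\cup\mathcal C_1\vdash B\Rightarrow T\downarrow\mathcal C_2$ and $T\longrightarrow^{\mathrm{wh}}s$; $\ \Gamma\uparrow\mathcal D\vdash t\,u\Rightarrow B[x\mapsto u]\downarrow\mathcal C_1\cup\mathcal C_2$ if $\Gamma\uparrow\mathcal D\vdash t\Rightarrow T\downarrow\mathcal C_1$, $T\longrightarrow^{\mathrm{wh}}(x:A)\to B$ and $\Gamma\uparrow\mathcal D\cup\mathcal C_1\vdash u\Leftarrow A\downarrow\mathcal C_2$. **Theorem (Correctness of elaboration).** Let $\Phi'$ be a local signature well-formed in $\mathbb{UPP}$, let $A,t$ be schematic terms, and let $c$ be a name that neither $\mathbb{UPP}$ nor $\Phi'$ declares. For a level substitution $\theta$, let $\vec i_{A[\theta]}$ be the level variables occurring free in $A[\theta]$, listed without repetition in any order, and let $\vec i_{t[\theta]\setminus A[\theta]}$ be those occurring free in $t[\theta]$ but not in $A[\theta]$. 1. Suppose $()\uparrow\emptyset\vdash A\Leftarrow\mathsf{Type}\downarrow\mathcal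 C_1$ and $()\uparrow\mathcal C_1\vdash t\Leftarrow A\downarrow\mathcal C_2$, and let $\theta$ be any unifier of $\mathcal C_1\cup\mathcal C_2$ (for instance the one that a unification procedure $\textsc{Unify}$ returns on $\mathcal C_1\cup\mathcal C_2$). Then $$\Phi',\ c:(\vec i_{A[\theta]}:\mathsf{Lvl})\to A[\theta]\ :=\ \vec i_{A[\theta]}.\ t[\theta][\vec i_{t[\theta]\setminus A[\theta]}\mapsto0]$$ is well-formed in $\mathbb{UPP}$. 2. Suppose $()\uparrow\emptyset\vdash A\Leftarrow\mathsf{Type}\downarrow\mathcal C_1$, and let $\theta$ be any unifier of $\mathcal C_1$. Then $\Phi',\ c:(\vec i_{A[\theta]}:\mathsf{Lvl})\to A[\theta]$ is well-formed in $\mathbb{UPP}$. -/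

import Mathlib

namespace UPP

/-!
The logical framework (Dedukti with confinement) instantiated with the theory UPP, extended by an
arbitrary local signature; then the constraint-computing elaborator.

Binding is represented by de Bruijn indices, with two independent index spaces: one for regular
variables (bound by `pi`, `lam`) and one for confined variables (bound by `cpi`, `clam`).
A confined variable that no binder captures is a free level variable; there are infinitely many.
-/

/-! ### Raw expressions -/

/-- Confined terms of UPP, i.e. universe levels: variables, `0`, `S l`, `l ⊔ l'`. -/
inductive Level : Type
  | var (i : ℕ)
  | zero
  | succ (l : Level)
  | max (l l' : Level)

/-- The two sorts of the framework. -/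
inductive DkSort : Type
  | type
  | kind

/-- Non-confined constants: the seven constants of the global signature of UPP, and the names
available for local signatures. -/
inductive Const : Type
  | lvl | ty | tm | univ | prod | abs | app
  | user (name : ℕ)

/-- Raw terms and types. -/
inductive Term : Type
  /-- a regular variable -/
  | var (x : ℕ)
  /-- a constant -/
  | const (c : Const)
  /-- `Type` or `Kind` -/
  | sort (s : DkSort)
  /-- `(x : A) → B` -/
  | pi (A B : Term)
  /-- `x. t` -/
  | lam (t : Term)
  /-- `t u` -/
  | app (t u : Term)
  /-- `(i : A) → B` with `i` confined -/
  | cpi (A B : Term)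
  /-- `i. t` with `i` confined -/
  | clam (t : Term)
  /-- `t l` with `l` confined -/
  | capp (t : Term) (l : Level)

/-! ### Renaming and substitution -/

/-- A level substitution; it is the identity (`Level.var`) outside its domain. -/
abbrev LevelSubst : Type := ℕ → Level

/-- `l[θ]`. -/
def Level.subst (θ : LevelSubst) : Level → Level
  | .var i => θ i
  | .zero => .zero
  | .succ l => .succ (l.subst θ)
  | .max l l' => .max (l.subst θ) (l'.subst θ)

/-- Free variables of a level. -/
def Level.fv : Level → Finset ℕ
  | .var i => {i}
  | .zero => ∅
  | .succ l => l.fv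
  | .max l l' => l.fv ∪ l'.fv

/-- Renaming of the variables of a level. -/
def Level.rename (ξ : ℕ → ℕ) (l : Level) : Level := l.subst fun i => .var (ξ i)

/-- Extension of a renaming below a binder of the same kind. -/
def upRen (ρ : ℕ → ℕ) : ℕ → ℕ
  | 0 => 0
  | n + 1 => ρ n + 1

/-- Simultaneous renaming of regular variables (by `ρ`) and confined variables (by `ξ`). -/
def Term.rename (ρ ξ : ℕ → ℕ) : Term → Term
  | .var x => .var (ρ x)
  | .const c => .const c
  | .sort s => .sort s
  | .pi A B => .pi (A.rename ρ ξ) (B.rename (upRen ρ) ξ)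
  | .lam t => .lam (t.rename (upRen ρ) ξ)
  | .app t u => .app (t.rename ρ ξ) (u.rename ρ ξ)
  | .cpi A B => .cpi (A.rename ρ ξ) (B.rename ρ (upRen ξ))
  | .clam t => .clam (t.rename ρ (upRen ξ))
  | .capp t l => .capp (t.rename ρ ξ) (l.rename ξ)

/-- Weakening by one regular variable. -/
def Term.shift (t : Term) : Term := t.rename Nat.succ id

/-- Weakening by one confined variable. -/
def Term.cshift (t : Term) : Term := t.rename id Nat.succ

/-- Extension of a level substitution below a confined binder. -/
def LevelSubst.up (θ : LevelSubst) : LevelSubst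
  | 0 => .var 0
  | n + 1 => (θ n).rename Nat.succ

/-- Extension of a substitution for regular variables below a regular binder. -/
def upSubst (σ : ℕ → Term) : ℕ → Term
  | 0 => .var 0
  | n + 1 => (σ n).shift

/-- Simultaneous capture-avoiding substitution of terms for regular variables and of levels for
confined variables. -/
def Term.subst (σ : ℕ → Term) (θ : LevelSubst) : Term → Term
  | .var x => σ x
  | .const c => .const c
  | .sort s => .sort s
  | .pi A B => .pi (A.subst σ θ) (B.subst (upSubst σ) θ)
  | .lam t => .lam (t.subst (upSubst σ) θ)
  | .app t u => .app (t.subst σ θ) (u.subst σ θ)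
  | .cpi A B => .cpi (A.subst σ θ) (B.subst (fun x => (σ x).cshift) θ.up)
  | .clam t => .clam (t.subst (fun x => (σ x).cshift) θ.up)
  | .capp t l => .capp (t.subst σ θ) (l.subst θ)

/-- `t[θ]` for a level substitution `θ`. -/
def Term.lsubst (θ : LevelSubst) (t : Term) : Term := t.subst .var θ

/-- `B[x ↦ u]`, where `x` is the regular variable with index `0`. -/
def Term.inst (B u : Term) : Term :=
  B.subst (fun n => match n with | 0 => u | k + 1 => .var k) .var

/-- `B[i ↦ l]`, where `i` is the confined variable with index `0`. -/
def Term.cinst (B : Term) (l : Level) : Term :=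
  B.lsubst (fun n => match n with | 0 => l | k + 1 => .var k)

/-- The free level variables of a term. -/
def Term.lfv : Term → Finset ℕ
  | .var _ => ∅
  | .const _ => ∅
  | .sort _ => ∅
  | .pi A B => A.lfv ∪ B.lfv
  | .lam t => t.lfv
  | .app t u => t.lfv ∪ u.lfv
  | .cpi A B => A.lfv ∪ (B.lfv.erase 0).image Nat.pred
  | .clam t => (t.lfv.erase 0).image Nat.pred
  | .capp t l => t.lfv ∪ l.fv

/-! ### The signature of UPP and local signatures -/

abbrev Lvl : Term := .const .lvl
abbrev Ty (l : Level) : Term := .capp (.const .ty) l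
abbrev Tm (l : Level) (A : Term) : Term := .app (.capp (.const .tm) l) A
abbrev U (l : Level) : Term := .capp (.const .univ) l
abbrev Prod (l l' : Level) (A B : Term) : Term :=
  .app (.app (.capp (.capp (.const .prod) l) l') A) B
abbrev Abs (l l' : Level) (A B t : Term) : Term :=
  .app (.app (.app (.capp (.capp (.const .abs) l) l') A) B) t
abbrev App (l l' : Level) (A B t u : Term) : Term :=
  .app (.app (.app (.app (.capp (.capp (.const .app) l) l') A) B) t) u

/-- An entry `c : A` (`body = none`) or `c : A := t` (`body = some t`) of a local signature. -/
structure Entry : Type where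
  name : ℕ
  type : Term
  body : Option Term

/-- A local signature, the most recent entry first: `Φ, e` is `e :: Φ`. -/
abbrev LocalSig : Type := List Entry

/-- `HasConst Φ c A`: the constant `c` is declared or defined with type `A` in the global signature
of UPP or in the local signature `Φ`.

In the global types, `(l l' : Lvl)` are the confined variables `1` and `0`. -/
inductive HasConst (Φ : LocalSig) : Const → Term → Prop
  /-- `Lvl : Type` -/
  | lvl : HasConst Φ .lvl (.sort .type)
  /-- `Ty : (l : Lvl) → Type` -/
  | ty : HasConst Φ .ty (.cpi Lvl (.sort .type))
  /-- `Tm : (l : Lvl) → Ty l → Type` -/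
  | tm : HasConst Φ .tm (.cpi Lvl (.pi (Ty (.var 0)) (.sort .type)))
  /-- `U : (l : Lvl) → Ty (S l)` -/
  | univ : HasConst Φ .univ (.cpi Lvl (Ty (.succ (.var 0))))
  /-- `Π : (l l' : Lvl) → (A : Ty l) → (B : Tm l A → Ty l') → Ty (l ⊔ l')` -/
  | prod : HasConst Φ .prod
      (.cpi Lvl (.cpi Lvl
        (.pi (Ty (.var 1))
        (.pi (.pi (Tm (.var 1) (.var 0)) (Ty (.var 0)))
          (Ty (.max (.var 1) (.var 0)))))))
  /-- `λ : (l l' : Lvl) → (A : Ty l) → (B : Tm l A → Ty l') → ((x : Tm l A) → Tm l' (B x)) →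
  Tm (l ⊔ l') (Π l l' A B)` -/
  | abs : HasConst Φ .abs
      (.cpi Lvl (.cpi Lvl
        (.pi (Ty (.var 1))
        (.pi (.pi (Tm (.var 1) (.var 0)) (Ty (.var 0)))
        (.pi (.pi (Tm (.var 1) (.var 1)) (Tm (.var 0) (.app (.var 1) (.var 0))))
          (Tm (.max (.var 1) (.var 0)) (Prod (.var 1) (.var 0) (.var 2) (.var 1))))))))
  /-- `@ : (l l' : Lvl) → (A : Ty l) → (B : Tm l A → Ty l') → (t : Tm (l ⊔ l') (Π l l' A B)) →
  (u : Tm l A) → Tm l' (B u)` -/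
  | app : HasConst Φ .app
      (.cpi Lvl (.cpi Lvl
        (.pi (Ty (.var 1))
        (.pi (.pi (Tm (.var 1) (.var 0)) (Ty (.var 0)))
        (.pi (Tm (.max (.var 1) (.var 0)) (Prod (.var 1) (.var 0) (.var 1) (.var 0)))
        (.pi (Tm (.var 1) (.var 2))
          (Tm (.var 0) (.app (.var 2) (.var 0)))))))))
  /-- constants of the local signature -/
  | user {e : Entry} : e ∈ Φ → HasConst Φ (.user e.name) e.type

/-! ### Conversion -/

/-- The equational theory of levels: the congruence generated by (all instances of) the six
equations of UPP. -/
inductive LevelEq : Level → Level → Prop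
  | refl (l) : LevelEq l l
  | symm {l l'} : LevelEq l l' → LevelEq l' l
  | trans {l l' l''} : LevelEq l l' → LevelEq l' l'' → LevelEq l l''
  | succ {l l'} : LevelEq l l' → LevelEq (.succ l) (.succ l')
  | max {l₁ l₁' l₂ l₂'} : LevelEq l₁ l₁' → LevelEq l₂ l₂' → LevelEq (.max l₁ l₂) (.max l₁' l₂')
  | max_assoc (l₁ l₂ l₃) : LevelEq (.max l₁ (.max l₂ l₃)) (.max (.max l₁ l₂) l₃)
  | max_comm (l₁ l₂) : LevelEq (.max l₁ l₂) (.max l₂ l₁)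
  | succ_max (l₁ l₂) : LevelEq (.succ (.max l₁ l₂)) (.max (.succ l₁) (.succ l₂))
  | max_succ_self (l) : LevelEq (.max l (.succ l)) (.succ l)
  | max_zero (l) : LevelEq (.max l .zero) l
  | max_self (l) : LevelEq (.max l l) l

/-- The relation `≃` on terms: same shape, with equivalent levels at corresponding places
(that is, the closure by context of `LevelEq`, which is an equivalence relation). -/
inductive TermEq : Term → Term → Prop
  | var (x) : TermEq (.var x) (.var x)
  | const (c) : TermEq (.const c) (.const c)
  | sort (s) : TermEq (.sort s) (.sort s)
  | pi {A A' B B'} : TermEq A A' → TermEq B B' → TermEq (.pi A B) (.pi A' B')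
  | lam {t t'} : TermEq t t' → TermEq (.lam t) (.lam t')
  | app {t t' u u'} : TermEq t t' → TermEq u u' → TermEq (.app t u) (.app t' u')
  | cpi {A A' B B'} : TermEq A A' → TermEq B B' → TermEq (.cpi A B) (.cpi A' B')
  | clam {t t'} : TermEq t t' → TermEq (.clam t) (.clam t')
  | capp {t t' l l'} : TermEq t t' → LevelEq l l' → TermEq (.capp t l) (.capp t' l')

/-- Instances of the rewrite rules: `β`, `β` for confined abstractions, the two rules of UPP, and
the unfolding `δ` of the definitions of `Φ`. -/
inductive RootStep (Φ : LocalSig) : Term → Term → Prop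
  | beta (t u) : RootStep Φ (.app (.lam t) u) (t.inst u)
  | cbeta (t l) : RootStep Φ (.capp (.clam t) l) (t.cinst l)
  | tm_univ (l' l) : RootStep Φ (Tm l' (U l)) (Ty l)
  | app_abs (l l' A B l'' l''' A' B' t u) :
      RootStep Φ (App l l' A B (Abs l'' l''' A' B' t) u) (.app t u)
  | delta {c A t} : (⟨c, A, some t⟩ : Entry) ∈ Φ → RootStep Φ (.const (.user c)) t

/-- One-step reduction `⟶`: the closure by context of `RootStep`. -/
inductive Step (Φ : LocalSig) : Term → Term → Prop
  | root {t t'} : RootStep Φ t t' → Step Φ t t'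
  | pi_left {A A' B} : Step Φ A A' → Step Φ (.pi A B) (.pi A' B)
  | pi_right {A B B'} : Step Φ B B' → Step Φ (.pi A B) (.pi A B')
  | lam {t t'} : Step Φ t t' → Step Φ (.lam t) (.lam t')
  | app_left {t t' u} : Step Φ t t' → Step Φ (.app t u) (.app t' u)
  | app_right {t u u'} : Step Φ u u' → Step Φ (.app t u) (.app t u')
  | cpi_left {A A' B} : Step Φ A A' → Step Φ (.cpi A B) (.cpi A' B)
  | cpi_right {A B B'} : Step Φ B B' → Step Φ (.cpi A B) (.cpi A B')
  | clam {t t'} : Step Φ t t' → Step Φ (.clam t) (.clam t')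
  | capp {t t' l} : Step Φ t t' → Step Φ (.capp t l) (.capp t' l)

/-- Many-step reduction. -/
def Steps (Φ : LocalSig) : Term → Term → Prop := Relation.ReflTransGen (Step Φ)

/-- Conversion `≡`: the equivalence relation generated by `⟶` and `≃`. -/
def Conv (Φ : LocalSig) : Term → Term → Prop :=
  Relation.EqvGen fun t u => Step Φ t u ∨ TermEq t u

/-! ### Typing -/

/-- Context entries `x : A` (`reg A`) and `i : A` (`conf A`). -/
inductive CtxEntry : Type
  | reg (A : Term)
  | conf (A : Term)

/-- Contexts, the most recent entry first: `Γ, x : A` is `.reg A :: Γ`. -/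
abbrev Ctx : Type := List CtxEntry

/-- `x : A ∈ Γ` for a regular variable (types are weakened to the whole of `Γ`). -/
inductive Lookup : Ctx → ℕ → Term → Prop
  | here {Γ A} : Lookup (.reg A :: Γ) 0 A.shift
  | reg {Γ x A B} : Lookup Γ x A → Lookup (.reg B :: Γ) (x + 1) A.shift
  | conf {Γ x A B} : Lookup Γ x A → Lookup (.conf B :: Γ) x A.cshift

/-- `i : A ∈ Γ` for a confined variable. -/
inductive CLookup : Ctx → ℕ → Term → Prop
  | here {Γ A} : CLookup (.conf A :: Γ) 0 A.cshift
  | conf {Γ i A B} : CLookup Γ i A → CLookup (.conf B :: Γ) (i + 1) A.cshift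
  | reg {Γ i A B} : CLookup Γ i A → CLookup (.reg B :: Γ) i A.shift

mutual

/-- `Γ ⊢` in UPP extended with `Φ`. -/
inductive WfCtx (Φ : LocalSig) : Ctx → Prop
  | nil : WfCtx Φ []
  | reg {Γ A} : HasType Φ Γ A (.sort .type) → WfCtx Φ (.reg A :: Γ)
  | conf {Γ A} : HasType Φ Γ A (.sort .type) → WfCtx Φ (.conf A :: Γ)

/-- `Γ ⊢ t : A` in UPP extended with `Φ`. -/
inductive HasType (Φ : LocalSig) : Ctx → Term → Term → Prop
  | sort {Γ} : WfCtx Φ Γ → HasType Φ Γ (.sort .type) (.sort .kind)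
  | var {Γ x A} : WfCtx Φ Γ → Lookup Γ x A → HasType Φ Γ (.var x) A
  | const {Γ c A} : WfCtx Φ Γ → HasConst Φ c A → HasType Φ Γ (.const c) A
  | conv {Γ t A B s} : HasType Φ Γ t A → HasType Φ Γ B (.sort s) → Conv Φ A B → HasType Φ Γ t B
  | pi {Γ A B s} : HasType Φ Γ A (.sort .type) → HasType Φ (.reg A :: Γ) B (.sort s) →
      HasType Φ Γ (.pi A B) (.sort s)
  | cpi {Γ A B s} : HasType Φ Γ A (.sort .type) → HasType Φ (.conf A :: Γ) B (.sort s) →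
      HasType Φ Γ (.cpi A B) (.sort s)
  | lam {Γ A B t s} : HasType Φ Γ A (.sort .type) → HasType Φ (.reg A :: Γ) B (.sort s) →
      HasType Φ (.reg A :: Γ) t B → HasType Φ Γ (.lam t) (.pi A B)
  | clam {Γ A B t s} : HasType Φ Γ A (.sort .type) → HasType Φ (.conf A :: Γ) B (.sort s) →
      HasType Φ (.conf A :: Γ) t B → HasType Φ Γ (.clam t) (.cpi A B)
  | app {Γ A B t u} : HasType Φ Γ t (.pi A B) → HasType Φ Γ u A → HasType Φ Γ (.app t u) (B.inst u)
  | capp {Γ A B t l} : HasType Φ Γ t (.cpi A B) → HasCType Φ Γ l A →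
      HasType Φ Γ (.capp t l) (B.cinst l)

/-- `Γ ⊢ l : A` for confined terms `l`, in UPP extended with `Φ`; the confined constants are
`0 : () → Lvl`, `S : (i : Lvl) → Lvl` and `⊔ : (i : Lvl, i' : Lvl) → Lvl`. -/
inductive HasCType (Φ : LocalSig) : Ctx → Level → Term → Prop
  | var {Γ i A} : WfCtx Φ Γ → CLookup Γ i A → HasCType Φ Γ (.var i) A
  | zero {Γ} : WfCtx Φ Γ → HasCType Φ Γ .zero Lvl
  | succ {Γ l} : HasCType Φ Γ l Lvl → HasCType Φ Γ (.succ l) Lvl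
  | max {Γ l l'} : HasCType Φ Γ l Lvl → HasCType Φ Γ l' Lvl → HasCType Φ Γ (.max l l') Lvl
  | conv {Γ l A B} : HasCType Φ Γ l A → HasType Φ Γ B (.sort .type) → Conv Φ A B →
      HasCType Φ Γ l B

end

/-- The name `c` is not used by any entry of `Φ`. -/
def Fresh (c : ℕ) (Φ : LocalSig) : Prop := ∀ e ∈ Φ, e.name ≠ c

/-- The local signature is well-formed in UPP: names are distinct and each entry is valid in UPP
extended with the entries that precede it. -/
inductive WfSig : LocalSig → Prop
  | nil : WfSig []
  | decl {Φ c A s} : WfSig Φ → Fresh c Φ → HasType Φ [] A (.sort s) →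
      WfSig (⟨c, A, none⟩ :: Φ)
  | defn {Φ c A t} : WfSig Φ → Fresh c Φ → HasType Φ [] t A →
      WfSig (⟨c, A, some t⟩ :: Φ)

/-! ### Schematic terms -/

/-- `c i₁ … iₖ` for level variables `i₁, …, iₖ`. -/
def constApp (c : Const) (is : List ℕ) : Term :=
  is.foldl (fun t i => .capp t (.var i)) (.const c)

/-- Schematic terms: no confined binders, and the only levels are level variables appearing as
arguments of constant applications. -/
inductive Schematic : Term → Prop
  | var (x) : Schematic (.var x)
  | const (c is) : Schematic (constApp c is)
  | sort (s) : Schematic (.sort s)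
  | pi {A B} : Schematic A → Schematic B → Schematic (.pi A B)
  | lam {t} : Schematic t → Schematic (.lam t)
  | app {t u} : Schematic t → Schematic u → Schematic (.app t u)

/-! ### Level constraints -/

/-- A level unification problem: a set of equations between levels. -/
abbrev Problem : Type := Set (Level × Level)

/-- `θ ⊨ C`: the level substitution `θ` is a unifier of the problem `C`. -/
def Unifies (θ : LevelSubst) (C : Problem) : Prop :=
  ∀ p ∈ C, LevelEq (p.1.subst θ) (p.2.subst θ)

/-! ### The elaborator -/

/-- `t a₁ … aₖ`, each `aᵢ` being a regular or confined term. -/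
def Term.apps (t : Term) (as : List (Term ⊕ Level)) : Term :=
  as.foldl (fun t a => match a with | .inl u => .app t u | .inr l => .capp t l) t

/-- Weak-head normal forms: whenever `u` reduces to `u' a₁ … aₖ`, the head `u'` matches no
left-hand side of a rewrite rule. -/
def Whnf (Φ : LocalSig) (u : Term) : Prop :=
  ∀ (u' : Term) (as : List (Term ⊕ Level)), Steps Φ u (u'.apps as) → ∀ v, ¬ RootStep Φ u' v

/-- Reduction to a weak-head normal form. -/
def WhSteps (Φ : LocalSig) (t u : Term) : Prop := Steps Φ t u ∧ Whnf Φ u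

mutual

/-- `A ≡ B ↓ C`. -/
inductive ConvGen (Φ : LocalSig) : Term → Term → Problem → Prop
  | mk {A B A' B' C} : WhSteps Φ A A' → WhSteps Φ B B' → ConvWhnf Φ A' B' C → ConvGen Φ A B C

/-- `A ≡ B ↓ C` for terms in weak-head normal form. -/
inductive ConvWhnf (Φ : LocalSig) : Term → Term → Problem → Prop
  | var (x) : ConvWhnf Φ (.var x) (.var x) ∅
  | const (c) : ConvWhnf Φ (.const c) (.const c) ∅
  | sort (s) : ConvWhnf Φ (.sort s) (.sort s) ∅
  | lam {t t' C} : ConvGen Φ t t' C → ConvWhnf Φ (.lam t) (.lam t') C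
  | pi {A A' B B' C₁ C₂} : ConvGen Φ A A' C₁ → ConvGen Φ B B' C₂ →
      ConvWhnf Φ (.pi A B) (.pi A' B') (C₁ ∪ C₂)
  | app {t t' u u' C₁ C₂} : ConvWhnf Φ t t' C₁ → ConvGen Φ u u' C₂ →
      ConvWhnf Φ (.app t u) (.app t' u') (C₁ ∪ C₂)
  | capp {t t' l l' C} : ConvWhnf Φ t t' C → ConvWhnf Φ (.capp t l) (.capp t' l') (C ∪ {(l, l')})

end

/-- `(j₁ … jₖ : Lvl) → B`. -/
def lvlPis : ℕ → Term → Term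
  | 0, B => B
  | k + 1, B => .cpi Lvl (lvlPis k B)

/-- The substitution `[j₁ … jₖ ↦ i₁ … iₖ]` for the body `B` of `(j₁ … jₖ : Lvl) → B`; the last
variable `jₖ` has index `0`, and the substitution removes the `k` bound indices. -/
def instLevels (is : List ℕ) : LevelSubst := fun n =>
  match is.reverse[n]? with
  | some i => .var i
  | none => .var (n - is.length)

mutual

/-- `Γ ↑ D ⊢ t ⇐ A ↓ C`. -/
inductive Check (Φ : LocalSig) : Ctx → Problem → Term → Term → Problem → Prop
  | switch {Γ D t A B C₁ C₂} : Infer Φ Γ D t A C₁ → ConvGen Φ A B C₂ →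
      Check Φ Γ D t B (C₁ ∪ C₂)
  | lam {Γ D t A B T C} : WhSteps Φ T (.pi A B) → Check Φ (.reg A :: Γ) D t B C →
      Check Φ Γ D (.lam t) T C

/-- `Γ ↑ D ⊢ t ⇒ A ↓ C`. -/
inductive Infer (Φ : LocalSig) : Ctx → Problem → Term → Term → Problem → Prop
  | var {Γ D x A} : Lookup Γ x A → Infer Φ Γ D (.var x) A ∅
  | const {Γ D c B} {is : List ℕ} : HasConst Φ c (lvlPis is.length B) →
      Infer Φ Γ D (constApp c is) (B.lsubst (instLevels is)) ∅
  | sort {Γ D} : Infer Φ Γ D (.sort .type) (.sort .kind) ∅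
  | pi {Γ D A B T s C₁ C₂} : Check Φ Γ D A (.sort .type) C₁ →
      Infer Φ (.reg A :: Γ) (D ∪ C₁) B T C₂ → WhSteps Φ T (.sort s) →
      Infer Φ Γ D (.pi A B) (.sort s) (C₁ ∪ C₂)
  | app {Γ D t u A B T C₁ C₂} : Infer Φ Γ D t T C₁ → WhSteps Φ T (.pi A B) →
      Check Φ Γ (D ∪ C₁) u A C₂ → Infer Φ Γ D (.app t u) (B.inst u) (C₁ ∪ C₂)

end

/-! ### Generalization over level variables -/

/-- The renaming that turns the free variable `i` into the variable bound by a new confined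
binder. -/
def captureRen (i : ℕ) : ℕ → ℕ := fun n => if n = i then 0 else n + 1

/-- `(i₁ … iₖ : Lvl) → A`, binding the free level variables `i₁, …, iₖ` of `A`. -/
def genPi (is : List ℕ) (A : Term) : Term :=
  is.foldr (fun i B => .cpi Lvl (B.rename id (captureRen i))) A

/-- `i₁ … iₖ. t`, binding the free level variables `i₁, …, iₖ` of `t`. -/
def genLam (is : List ℕ) (t : Term) : Term :=
  is.foldr (fun i u => .clam (u.rename id (captureRen i))) t

/-- The level substitution mapping the variables in `X` to `0`. -/
def zeroOn (X : Finset ℕ) : LevelSubst := fun n => if n ∈ X then .zero else .var n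

/-- `is` lists, without repetition, the elements of `X`. -/
def Enumerates (is : List ℕ) (X : Finset ℕ) : Prop := is.Nodup ∧ ∀ i, i ∈ is ↔ i ∈ X

end UPP

namespace UPP

/-! ### Substitution calculus -/

namespace Level

theorem subst_subst (θ θ' : LevelSubst) (l : Level) :
    (l.subst θ).subst θ' = l.subst fun i => (θ i).subst θ' := by
  induction l <;> simp_all [Level.subst]

@[simp] theorem subst_var (l : Level) : l.subst .var = l := by
  induction l <;> simp_all [Level.subst]

theorem subst_congr_fv {θ θ' : LevelSubst} {l : Level} (h : ∀ i ∈ l.fv, θ i = θ' i) :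
    l.subst θ = l.subst θ' := by
  induction l <;> simp_all [Level.subst, Level.fv]

end Level

@[simp] theorem upSubst_var : upSubst .var = .var := by
  funext n; cases n <;> rfl

@[simp] theorem up_var : LevelSubst.up .var = .var := by
  funext n; cases n <;> rfl

@[simp] theorem upSubst_var_comp (ρ : ℕ → ℕ) :
    upSubst (fun x => .var (ρ x)) = fun x => .var (upRen ρ x) := by
  funext n; cases n <;> rfl

@[simp] theorem up_var_comp (ξ : ℕ → ℕ) :
    LevelSubst.up (fun x => .var (ξ x)) = fun x => .var (upRen ξ x) := by
  funext n; cases n <;> rfl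

namespace Term

theorem rename_eq_subst (ρ ξ : ℕ → ℕ) (t : Term) :
    t.rename ρ ξ = t.subst (fun x => .var (ρ x)) (fun i => .var (ξ i)) := by
  induction t generalizing ρ ξ <;>
    simp_all [Term.rename, Term.subst, Level.rename, Term.cshift]

@[simp] theorem subst_var (t : Term) : t.subst .var .var = t := by
  induction t <;> simp_all [Term.subst, Term.cshift, Term.rename]

theorem rename_subst (ρ ξ : ℕ → ℕ) (σ : ℕ → Term) (θ : LevelSubst) (t : Term) :
    (t.rename ρ ξ).subst σ θ = t.subst (fun x => σ (ρ x)) (fun i => θ (ξ i)) := by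
  have hσ : ∀ (ρ : ℕ → ℕ) (σ : ℕ → Term),
      (fun x => upSubst σ (upRen ρ x)) = upSubst fun x => σ (ρ x) := by
    intro ρ σ; funext n; cases n <;> rfl
  have hθ : ∀ (ξ : ℕ → ℕ) (θ : LevelSubst),
      (fun x => θ.up (upRen ξ x)) = LevelSubst.up fun x => θ (ξ x) := by
    intro ρ σ; funext n; cases n <;> rfl
  induction t generalizing ρ ξ σ θ <;>
    simp_all [Term.rename, Term.subst, Level.rename, Level.subst_subst, Level.subst]

theorem rename_rename (ρ ξ ρ' ξ' : ℕ → ℕ) (t : Term) :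
    (t.rename ρ ξ).rename ρ' ξ' = t.rename (fun x => ρ' (ρ x)) (fun i => ξ' (ξ i)) := by
  rw [rename_eq_subst ρ' ξ', rename_subst, rename_eq_subst]

theorem subst_rename (ρ ξ : ℕ → ℕ) (σ : ℕ → Term) (θ : LevelSubst) (t : Term) :
    (t.subst σ θ).rename ρ ξ =
      t.subst (fun x => (σ x).rename ρ ξ) (fun i => (θ i).rename ξ) := by
  have hσ : ∀ (ρ ξ : ℕ → ℕ) (σ : ℕ → Term),
      (fun x => (upSubst σ x).rename (upRen ρ) ξ) = upSubst fun x => (σ x).rename ρ ξ := by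
    intro ρ ξ σ; funext n
    cases n with
    | zero => rfl
    | succ n => simp only [upSubst, Term.shift, rename_rename]; rfl
  have hc : ∀ (ρ ξ : ℕ → ℕ) (σ : ℕ → Term),
      (fun x => ((σ x).cshift).rename ρ (upRen ξ)) = fun x => ((σ x).rename ρ ξ).cshift := by
    intro ρ ξ σ; funext n
    simp only [Term.cshift, rename_rename]; rfl
  have hθ : ∀ (ξ : ℕ → ℕ) (θ : LevelSubst),
      (fun x => (θ.up x).rename (upRen ξ)) = LevelSubst.up fun x => (θ x).rename ξ := by
    intro ξ θ; funext n
    cases n with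
    | zero => rfl
    | succ n => simp only [LevelSubst.up, Level.rename, Level.subst_subst]; rfl
  induction t generalizing ρ ξ σ θ <;>
    simp_all [Term.rename, Term.subst]
  simp [Level.rename, Level.subst_subst]

theorem subst_subst (σ σ' : ℕ → Term) (θ θ' : LevelSubst) (t : Term) :
    (t.subst σ θ).subst σ' θ' =
      t.subst (fun x => (σ x).subst σ' θ') (fun i => (θ i).subst θ') := by
  have hσ : ∀ (σ σ' : ℕ → Term) (θ' : LevelSubst),
      (fun x => (upSubst σ x).subst (upSubst σ') θ') =
        upSubst fun x => (σ x).subst σ' θ' := by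
    intro σ σ' θ'; funext n
    cases n with
    | zero => rfl
    | succ n => simp [upSubst, Term.shift, rename_subst, subst_rename, Level.rename]
  have hc : ∀ (σ σ' : ℕ → Term) (θ' : LevelSubst),
      (fun x => ((σ x).cshift).subst (fun x => (σ' x).cshift) θ'.up) =
        fun x => ((σ x).subst σ' θ').cshift := by
    intro σ σ' θ'; funext n
    simp only [Term.cshift, rename_subst, subst_rename]; rfl
  have hθ : ∀ (θ θ' : LevelSubst),
      (fun x => (θ.up x).subst θ'.up) = LevelSubst.up fun x => (θ x).subst θ' := by
    intro θ θ'; funext n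
    cases n with
    | zero => rfl
    | succ n => simp only [LevelSubst.up, Level.rename, Level.subst_subst]; rfl
  induction t generalizing σ σ' θ θ' <;>
    simp_all [Term.subst, Level.subst_subst]

/-- The substitution `x ↦ u` of the regular variable with index `0`. -/
def single (u : Term) : ℕ → Term
  | 0 => u
  | k + 1 => .var k

end Term

/-- The extension of a level substitution by a level for the variable with index `0`. -/
def Level.cons (l : Level) (θ : LevelSubst) : LevelSubst
  | 0 => l
  | k + 1 => θ k

namespace Term

theorem inst_eq (B u : Term) : B.inst u = B.subst (single u) .var := by
  rw [Term.inst]; congr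

theorem cinst_eq (B : Term) (l : Level) : B.cinst l = B.subst .var (l.cons .var) := by
  rw [Term.cinst, Term.lsubst]; congr

theorem shift_subst (σ : ℕ → Term) (θ : LevelSubst) (t : Term) :
    t.shift.subst (upSubst σ) θ = (t.subst σ θ).shift := by
  simp only [Term.shift, rename_subst, subst_rename, upSubst]
  simp [Level.rename]

theorem cshift_subst (σ : ℕ → Term) (θ : LevelSubst) (t : Term) :
    t.cshift.subst (fun x => (σ x).cshift) θ.up = (t.subst σ θ).cshift := by
  simp only [Term.cshift, rename_subst, subst_rename]; rfl

theorem shift_rename (ρ ξ : ℕ → ℕ) (t : Term) :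
    t.shift.rename (upRen ρ) ξ = (t.rename ρ ξ).shift := by
  simp only [Term.shift, rename_rename]; rfl

theorem cshift_rename (ρ ξ : ℕ → ℕ) (t : Term) :
    t.cshift.rename ρ (upRen ξ) = (t.rename ρ ξ).cshift := by
  simp only [Term.cshift, rename_rename]; rfl

@[simp] theorem shift_inst (t u : Term) : t.shift.inst u = t := by
  simp only [inst_eq, Term.shift, rename_subst]; exact subst_var t

@[simp] theorem cshift_cinst (t : Term) (l : Level) : t.cshift.cinst l = t := by
  simp only [cinst_eq, Term.cshift, rename_subst]; exact subst_var t

theorem inst_subst (σ : ℕ → Term) (θ : LevelSubst) (B u : Term) :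
    (B.inst u).subst σ θ = (B.subst (upSubst σ) θ).inst (u.subst σ θ) := by
  simp only [inst_eq, subst_subst]
  congr 1
  · funext n
    cases n with
    | zero => rfl
    | succ n =>
      change σ n = (σ n).shift.subst _ _
      rw [← inst_eq, shift_inst]
  · simp [Level.subst]

theorem cinst_subst (σ : ℕ → Term) (θ : LevelSubst) (B : Term) (l : Level) :
    (B.cinst l).subst σ θ =
      (B.subst (fun x => (σ x).cshift) θ.up).cinst (l.subst θ) := by
  simp only [cinst_eq, subst_subst]
  congr 1
  · funext n
    rw [← cinst_eq, cshift_cinst]; rfl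
  · funext n
    cases n with
    | zero => rfl
    | succ n =>
      simp only [Level.cons, LevelSubst.up, Level.rename, Level.subst_subst, Level.subst]
      exact (Level.subst_var _).symm

theorem inst_rename (ρ ξ : ℕ → ℕ) (B u : Term) :
    (B.inst u).rename ρ ξ = (B.rename (upRen ρ) ξ).inst (u.rename ρ ξ) := by
  simp [rename_eq_subst, inst_subst]

theorem cinst_rename (ρ ξ : ℕ → ℕ) (B : Term) (l : Level) :
    (B.cinst l).rename ρ ξ = (B.rename ρ (upRen ξ)).cinst (l.rename ξ) := by
  simp only [rename_eq_subst, cinst_subst, up_var_comp]; rfl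

theorem subst_up_cinst (θ : LevelSubst) (B : Term) (l : Level) :
    (B.subst .var θ.up).cinst l = B.subst .var (l.cons θ) := by
  simp only [cinst_eq, subst_subst]
  congr 1
  funext n
  cases n with
  | zero => rfl
  | succ n =>
    simp only [LevelSubst.up, Level.rename, Level.subst_subst, Level.subst]
    exact Level.subst_var _

theorem lsubst_congr_lfv {σ : ℕ → Term} {θ θ' : LevelSubst} {t : Term}
    (h : ∀ i ∈ t.lfv, θ i = θ' i) : t.subst σ θ = t.subst σ θ' := by
  have hup : ∀ {X : Finset ℕ} {θ θ' : LevelSubst},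
      (∀ i ∈ (X.erase 0).image Nat.pred, θ i = θ' i) → ∀ i ∈ X, θ.up i = θ'.up i := by
    intro X θ θ' h i hi
    cases i with
    | zero => rfl
    | succ i =>
      have := h i (Finset.mem_image.2 ⟨i + 1, by simp [hi], rfl⟩)
      simp [LevelSubst.up, this]
  induction t generalizing σ θ θ' with
  | var | const | sort => rfl
  | pi A B ihA ihB | app A B ihA ihB =>
    simp only [Term.lfv, Finset.mem_union] at h
    simp only [Term.subst]
    rw [ihA fun i hi => h i (.inl hi), ihB fun i hi => h i (.inr hi)]
  | lam t ih => simp only [Term.subst]; rw [ih h]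
  | cpi A B ihA ihB =>
    simp only [Term.lfv, Finset.mem_union] at h
    simp only [Term.subst]
    rw [ihA fun i hi => h i (.inl hi), ihB (hup fun i hi => h i (.inr hi))]
  | clam t ih => simp only [Term.subst]; rw [ih (hup h)]
  | capp t l ih =>
    simp only [Term.lfv, Finset.mem_union] at h
    simp only [Term.subst]
    rw [ih fun i hi => h i (.inl hi), Level.subst_congr_fv fun i hi => h i (.inr hi)]

end Term

/-! ### Levels and `≃` -/

theorem LevelEq.subst {l l' : Level} (h : LevelEq l l') {θ θ' : LevelSubst}
    (hθ : ∀ i, LevelEq (θ i) (θ' i)) : LevelEq (l.subst θ) (l'.subst θ') := by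
  have key : ∀ l : Level, LevelEq (l.subst θ) (l.subst θ') := by
    intro l
    induction l with
    | var i => exact hθ i
    | zero => exact .refl _
    | succ l ih => exact .succ ih
    | max l l' ih ih' => exact .max ih ih'
  refine LevelEq.trans ?_ (key l')
  clear key
  induction h with
  | refl l => exact .refl _
  | symm _ ih => exact .symm ih
  | trans _ _ ih ih' => exact .trans ih ih'
  | succ _ ih => exact .succ ih
  | max _ _ ih ih' => exact .max ih ih'
  | max_assoc l₁ l₂ l₃ => exact .max_assoc _ _ _
  | max_comm l₁ l₂ => exact .max_comm _ _
  | succ_max l₁ l₂ => exact .succ_max _ _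
  | max_succ_self l => exact .max_succ_self _
  | max_zero l => exact .max_zero _
  | max_self l => exact .max_self _

theorem TermEq.refl (t : Term) : TermEq t t := by
  induction t <;> constructor <;> first | assumption | exact .refl _

/-! ### Congruence of conversion -/

section Conv
variable {Φ : LocalSig}

theorem Conv.refl (t : Term) : Conv Φ t t := Relation.EqvGen.refl _
theorem Conv.symm {t u : Term} (h : Conv Φ t u) : Conv Φ u t := Relation.EqvGen.symm _ _ h
theorem Conv.trans {t u v : Term} (h : Conv Φ t u) (h' : Conv Φ u v) : Conv Φ t v :=
  Relation.EqvGen.trans _ _ _ h h'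
theorem Conv.step {t u : Term} (h : Step Φ t u) : Conv Φ t u := .rel _ _ (.inl h)
theorem Conv.root {t u : Term} (h : RootStep Φ t u) : Conv Φ t u := .step (.root h)
theorem Conv.termEq {t u : Term} (h : TermEq t u) : Conv Φ t u := .rel _ _ (.inr h)

theorem Conv.steps {t u : Term} (h : Steps Φ t u) : Conv Φ t u := by
  induction h with
  | refl => exact .refl _
  | tail _ h ih => exact ih.trans (.step h)

theorem Conv.map {f : Term → Term} (hs : ∀ {t u}, Step Φ t u → Step Φ (f t) (f u))
    (he : ∀ {t u}, TermEq t u → TermEq (f t) (f u)) {t u : Term} (h : Conv Φ t u) :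
    Conv Φ (f t) (f u) := by
  induction h with
  | rel _ _ h => exact .rel _ _ (h.imp hs he)
  | refl => exact .refl _
  | symm _ _ _ ih => exact ih.symm
  | trans _ _ _ _ _ ih ih' => exact ih.trans ih'

theorem Conv.pi {A A' B B' : Term} (hA : Conv Φ A A') (hB : Conv Φ B B') :
    Conv Φ (.pi A B) (.pi A' B') :=
  (hA.map (f := (.pi · B)) .pi_left (.pi · (.refl _))).trans (hB.map .pi_right (.pi (.refl _) ·))

theorem Conv.cpi {A A' B B' : Term} (hA : Conv Φ A A') (hB : Conv Φ B B') :
    Conv Φ (.cpi A B) (.cpi A' B') :=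
  (hA.map (f := (.cpi · B)) .cpi_left (.cpi · (.refl _))).trans
    (hB.map .cpi_right (.cpi (.refl _) ·))

theorem Conv.app {t t' u u' : Term} (ht : Conv Φ t t') (hu : Conv Φ u u') :
    Conv Φ (.app t u) (.app t' u') :=
  (ht.map (f := (.app · u)) .app_left (.app · (.refl _))).trans
    (hu.map .app_right (.app (.refl _) ·))

theorem Conv.lam {t t' : Term} (h : Conv Φ t t') : Conv Φ (.lam t) (.lam t') :=
  h.map .lam .lam

theorem Conv.clam {t t' : Term} (h : Conv Φ t t') : Conv Φ (.clam t) (.clam t') :=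
  h.map .clam .clam

theorem Conv.capp {t t' : Term} {l l' : Level} (h : Conv Φ t t') (hl : LevelEq l l') :
    Conv Φ (.capp t l) (.capp t' l') :=
  (h.map (f := (.capp · l)) .capp (.capp · (.refl _))).trans (.termEq (.capp (.refl _) hl))

end Conv

/-! ### Parallel reduction modulo `≃` -/

/-- Parallel reduction, which may moreover replace levels by equivalent ones. -/
inductive Par (Φ : LocalSig) : Term → Term → Prop
  | var (x) : Par Φ (.var x) (.var x)
  | const (c) : Par Φ (.const c) (.const c)
  | sort (s) : Par Φ (.sort s) (.sort s)
  | pi {A A' B B'} : Par Φ A A' → Par Φ B B' → Par Φ (.pi A B) (.pi A' B')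
  | lam {t t'} : Par Φ t t' → Par Φ (.lam t) (.lam t')
  | app {t t' u u'} : Par Φ t t' → Par Φ u u' → Par Φ (.app t u) (.app t' u')
  | cpi {A A' B B'} : Par Φ A A' → Par Φ B B' → Par Φ (.cpi A B) (.cpi A' B')
  | clam {t t'} : Par Φ t t' → Par Φ (.clam t) (.clam t')
  | capp {t t' l l'} : Par Φ t t' → LevelEq l l' → Par Φ (.capp t l) (.capp t' l')
  | beta {t t' u u'} : Par Φ t t' → Par Φ u u' → Par Φ (.app (.lam t) u) (t'.inst u')
  | cbeta {t t' l l'} : Par Φ t t' → LevelEq l l' → Par Φ (.capp (.clam t) l) (t'.cinst l')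
  | tm_univ {l₀ l l'} : LevelEq l l' → Par Φ (Tm l₀ (U l)) (Ty l')
  | app_abs {l₁ l₂ A B l₃ l₄ A' B' t t' u u'} : Par Φ t t' → Par Φ u u' →
      Par Φ (App l₁ l₂ A B (Abs l₃ l₄ A' B' t) u) (.app t' u')
  | delta {c A t} : (⟨c, A, some t⟩ : Entry) ∈ Φ → Par Φ (.const (.user c)) t

/-- The properties of a local signature on which reduction depends: definitions are unique and
their bodies are closed. -/
structure RedSig (Φ : LocalSig) : Prop where
  body_unique {c A t A' t'} : (⟨c, A, some t⟩ : Entry) ∈ Φ → (⟨c, A', some t'⟩ : Entry) ∈ Φ → t = t'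
  body_closed {c A t} : (⟨c, A, some t⟩ : Entry) ∈ Φ → ∀ σ θ, t.subst σ θ = t

section Par
variable {Φ : LocalSig}

theorem Par.refl (t : Term) : Par Φ t t := by
  induction t <;> constructor <;> first | assumption | exact .refl _

theorem Par.of_root {t u : Term} (h : RootStep Φ t u) : Par Φ t u := by
  cases h with
  | beta t u => exact .beta (.refl _) (.refl _)
  | cbeta t l => exact .cbeta (.refl _) (.refl _)
  | tm_univ => exact .tm_univ (.refl _)
  | app_abs => exact .app_abs (.refl _) (.refl _)
  | delta h => exact .delta h

theorem Par.of_step {t u : Term} (h : Step Φ t u) : Par Φ t u := by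
  induction h with
  | root h => exact .of_root h
  | pi_left _ ih => exact .pi ih (.refl _)
  | pi_right _ ih => exact .pi (.refl _) ih
  | lam _ ih => exact .lam ih
  | app_left _ ih => exact .app ih (.refl _)
  | app_right _ ih => exact .app (.refl _) ih
  | cpi_left _ ih => exact .cpi ih (.refl _)
  | cpi_right _ ih => exact .cpi (.refl _) ih
  | clam _ ih => exact .clam ih
  | capp _ ih => exact .capp ih (.refl _)

theorem Par.of_termEq {t u : Term} (h : TermEq t u) : Par Φ t u := by
  induction h <;> constructor <;> assumption

theorem Par.conv {t u : Term} (h : Par Φ t u) : Conv Φ t u := by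
  induction h with
  | var | const | sort => exact .refl _
  | pi _ _ ih ih' => exact .pi ih ih'
  | lam _ ih => exact .lam ih
  | app _ _ ih ih' => exact .app ih ih'
  | cpi _ _ ih ih' => exact .cpi ih ih'
  | clam _ ih => exact .clam ih
  | capp _ hl ih => exact .capp ih hl
  | beta _ _ ih ih' => exact (Conv.app (.lam ih) ih').trans (.root (.beta _ _))
  | cbeta _ hl ih => exact (Conv.capp (.clam ih) hl).trans (.root (.cbeta _ _))
  | tm_univ hl => exact (Conv.root (.tm_univ _ _)).trans (.capp (.refl _) hl)
  | app_abs _ _ ih ih' => exact (Conv.root (.app_abs ..)).trans (.app ih ih')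
  | delta h => exact .root (.delta h)

variable (hΦ : RedSig Φ)
include hΦ

theorem Par.rename {t u : Term} (h : Par Φ t u) (ρ ξ : ℕ → ℕ) :
    Par Φ (t.rename ρ ξ) (u.rename ρ ξ) := by
  have hl : ∀ {l l' : Level} (ξ : ℕ → ℕ), LevelEq l l' → LevelEq (l.rename ξ) (l'.rename ξ) :=
    fun ξ h => h.subst fun _ => .refl _
  induction h generalizing ρ ξ with
  | var | const | sort => exact .refl _
  | pi _ _ ih ih' => exact .pi (ih ..) (ih' ..)
  | lam _ ih => exact .lam (ih ..)
  | app _ _ ih ih' => exact .app (ih ..) (ih' ..)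
  | cpi _ _ ih ih' => exact .cpi (ih ..) (ih' ..)
  | clam _ ih => exact .clam (ih ..)
  | capp _ h ih => exact .capp (ih ..) (hl _ h)
  | beta _ _ ih ih' => rw [Term.inst_rename]; exact .beta (ih ..) (ih' ..)
  | cbeta _ h ih => rw [Term.cinst_rename]; exact .cbeta (ih ..) (hl _ h)
  | tm_univ h => exact .tm_univ (hl _ h)
  | app_abs _ _ ih ih' => exact .app_abs (ih ..) (ih' ..)
  | delta h =>
    rw [Term.rename_eq_subst, Term.rename_eq_subst, hΦ.body_closed h]
    exact .delta h

theorem Par.subst {t u : Term} (h : Par Φ t u) {σ σ' : ℕ → Term} {θ θ' : LevelSubst}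
    (hσ : ∀ x, Par Φ (σ x) (σ' x)) (hθ : ∀ i, LevelEq (θ i) (θ' i)) :
    Par Φ (t.subst σ θ) (u.subst σ' θ') := by
  have uσ : ∀ {σ σ' : ℕ → Term}, (∀ x, Par Φ (σ x) (σ' x)) →
      ∀ x, Par Φ (upSubst σ x) (upSubst σ' x) := by
    rintro σ σ' h (_ | x)
    · exact .refl _
    · exact (h x).rename hΦ _ _
  have cσ : ∀ {σ σ' : ℕ → Term}, (∀ x, Par Φ (σ x) (σ' x)) →
      ∀ x, Par Φ (σ x).cshift (σ' x).cshift := fun h x => (h x).rename hΦ _ _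
  have uθ : ∀ {θ θ' : LevelSubst}, (∀ i, LevelEq (θ i) (θ' i)) →
      ∀ i, LevelEq (θ.up i) (θ'.up i) := by
    rintro θ θ' h (_ | x)
    · exact .refl _
    · exact (h x).subst fun _ => .refl _
  induction h generalizing σ σ' θ θ' with
  | var => exact hσ _
  | const | sort => exact .refl _
  | pi _ _ ih ih' => exact .pi (ih hσ hθ) (ih' (uσ hσ) hθ)
  | lam _ ih => exact .lam (ih (uσ hσ) hθ)
  | app _ _ ih ih' => exact .app (ih hσ hθ) (ih' hσ hθ)
  | cpi _ _ ih ih' => exact .cpi (ih hσ hθ) (ih' (cσ hσ) (uθ hθ))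
  | clam _ ih => exact .clam (ih (cσ hσ) (uθ hθ))
  | capp _ h ih => exact .capp (ih hσ hθ) (h.subst hθ)
  | beta _ _ ih ih' => rw [Term.inst_subst]; exact .beta (ih (uσ hσ) hθ) (ih' hσ hθ)
  | cbeta _ h ih => rw [Term.cinst_subst]; exact .cbeta (ih (cσ hσ) (uθ hθ)) (h.subst hθ)
  | tm_univ h => exact .tm_univ (h.subst hθ)
  | app_abs _ _ ih ih' => exact .app_abs (ih hσ hθ) (ih' hσ hθ)
  | delta h => rw [hΦ.body_closed h]; exact .delta h

theorem Par.inst {t t' u u' : Term} (ht : Par Φ t t') (hu : Par Φ u u') :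
    Par Φ (t.inst u) (t'.inst u') := by
  rw [Term.inst_eq, Term.inst_eq]
  refine ht.subst hΦ ?_ fun _ => .refl _
  rintro (_ | x)
  exacts [hu, .refl _]

theorem Par.cinst {t t' : Term} {l l' : Level} (ht : Par Φ t t') (hl : LevelEq l l') :
    Par Φ (t.cinst l) (t'.cinst l') := by
  rw [Term.cinst_eq, Term.cinst_eq]
  refine ht.subst hΦ (fun _ => .refl _) ?_
  rintro (_ | x)
  exacts [hl, .refl _]

omit hΦ in
theorem Par.lam_inv {t u : Term} (h : Par Φ (.lam t) u) : ∃ t', u = .lam t' ∧ Par Φ t t' := by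
  cases h with | lam h => exact ⟨_, rfl, h⟩

omit hΦ in
theorem Par.clam_inv {t u : Term} (h : Par Φ (.clam t) u) : ∃ t', u = .clam t' ∧ Par Φ t t' := by
  cases h with | clam h => exact ⟨_, rfl, h⟩

omit hΦ in
theorem Par.tm_head_inv {l : Level} {u : Term} (h : Par Φ (.capp (.const .tm) l) u) :
    ∃ l', u = .capp (.const .tm) l' := by
  cases h with | capp h h' => cases h; exact ⟨_, rfl⟩

omit hΦ in
theorem Par.univ_inv {l : Level} {u : Term} (h : Par Φ (U l) u) :
    ∃ l', u = U l' ∧ LevelEq l l' := by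
  cases h with | capp h h' => cases h; exact ⟨_, rfl, h'⟩

omit hΦ in
theorem Par.abs_inv {l l' : Level} {A B t u : Term} (h : Par Φ (Abs l l' A B t) u) :
    ∃ m m' A' B' t', u = Abs m m' A' B' t' ∧ LevelEq l m ∧ LevelEq l' m' ∧ Par Φ A A' ∧
      Par Φ B B' ∧ Par Φ t t' := by
  cases h with | app h h₁ => cases h with | app h h₂ => cases h with | app h h₃ =>
    cases h with | capp h h₄ => cases h with | capp h h₅ =>
    cases h
    exact ⟨_, _, _, _, _, rfl, h₅, h₄, h₃, h₂, h₁⟩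

omit hΦ in
theorem Par.app_head_inv {l l' : Level} {A B t u : Term}
    (h : Par Φ (.app (.app (.app (.capp (.capp (.const .app) l) l') A) B) t) u) :
    ∃ m m' A' B' t', u = .app (.app (.app (.capp (.capp (.const .app) m) m') A') B') t' ∧
      Par Φ t t' := by
  cases h with | app h h₁ => cases h with | app h h₂ => cases h with | app h h₃ =>
    cases h with | capp h h₄ => cases h with | capp h h₅ =>
    cases h
    exact ⟨_, _, _, _, _, rfl, h₁⟩

theorem Par.diamond {s t u : Term} (ht : Par Φ s t) (hu : Par Φ s u) :
    ∃ v, Par Φ t v ∧ Par Φ u v := by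
  induction ht generalizing u with
  | var | sort => exact ⟨u, hu, .refl _⟩
  | const c => exact ⟨u, hu, .refl _⟩
  | pi _ _ ih ih' =>
    cases hu with | pi h h' =>
    obtain ⟨⟨v, h₁, h₂⟩, ⟨v', h₁', h₂'⟩⟩ := And.intro (ih h) (ih' h')
    exact ⟨_, .pi h₁ h₁', .pi h₂ h₂'⟩
  | cpi _ _ ih ih' =>
    cases hu with | cpi h h' =>
    obtain ⟨⟨v, h₁, h₂⟩, ⟨v', h₁', h₂'⟩⟩ := And.intro (ih h) (ih' h')
    exact ⟨_, .cpi h₁ h₁', .cpi h₂ h₂'⟩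
  | lam _ ih =>
    cases hu with | lam h =>
    obtain ⟨v, h₁, h₂⟩ := ih h
    exact ⟨_, .lam h₁, .lam h₂⟩
  | clam _ ih =>
    cases hu with | clam h =>
    obtain ⟨v, h₁, h₂⟩ := ih h
    exact ⟨_, .clam h₁, .clam h₂⟩
  | app h₀ h₀' ih ih' =>
    cases hu with
    | app h h' =>
      obtain ⟨⟨v, h₁, h₂⟩, ⟨v', h₁', h₂'⟩⟩ := And.intro (ih h) (ih' h')
      exact ⟨_, .app h₁ h₁', .app h₂ h₂'⟩
    | beta h h' =>
      obtain ⟨⟨v, h₁, h₂⟩, ⟨v', h₁', h₂'⟩⟩ := And.intro (ih (.lam h)) (ih' h')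
      obtain ⟨_, rfl, -⟩ := h₀.lam_inv
      obtain ⟨_, rfl, k₂⟩ := h₂.lam_inv
      obtain ⟨_, e, k₁⟩ := h₁.lam_inv
      cases e
      exact ⟨_, .beta k₁ h₁', .inst hΦ k₂ h₂'⟩
    | tm_univ h =>
      obtain ⟨_, rfl⟩ := h₀.tm_head_inv
      obtain ⟨_, rfl, h'⟩ := h₀'.univ_inv
      exact ⟨_, .tm_univ (h'.symm.trans h), .refl _⟩
    | app_abs h h' =>
      obtain ⟨v', h₁', h₂'⟩ := ih' h'
      obtain ⟨v, h₁, h₂⟩ := ih (.app (.refl _) (.app (.refl _) h))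
      obtain ⟨_, _, _, _, _, rfl, k₀⟩ := h₀.app_head_inv
      obtain ⟨_, _, _, _, _, rfl, k₂⟩ := h₂.app_head_inv
      obtain ⟨_, _, _, _, _, e, k₁⟩ := h₁.app_head_inv
      cases e
      obtain ⟨_, _, _, _, _, rfl, -⟩ := k₀.abs_inv
      obtain ⟨_, _, _, _, _, rfl, -, -, -, -, m₂⟩ := k₂.abs_inv
      obtain ⟨_, _, _, _, _, e, -, -, -, -, m₁⟩ := k₁.abs_inv
      cases e
      exact ⟨_, .app_abs m₁ h₁', .app m₂ h₂'⟩
  | capp h₀ hl ih =>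
    cases hu with
    | capp h h' =>
      obtain ⟨v, h₁, h₂⟩ := ih h
      exact ⟨_, .capp h₁ hl.symm, .capp h₂ h'.symm⟩
    | cbeta h h' =>
      obtain ⟨v, h₁, h₂⟩ := ih (.clam h)
      obtain ⟨_, rfl, -⟩ := h₀.clam_inv
      obtain ⟨_, rfl, k₂⟩ := h₂.clam_inv
      obtain ⟨_, e, k₁⟩ := h₁.clam_inv
      cases e
      exact ⟨_, .cbeta k₁ (hl.symm.trans h'), .cinst hΦ k₂ (.refl _)⟩
  | beta _ _ ih ih' =>
    cases hu with
    | app h h' =>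
      obtain ⟨_, rfl, k⟩ := h.lam_inv
      obtain ⟨⟨v, h₁, h₂⟩, ⟨v', h₁', h₂'⟩⟩ := And.intro (ih k) (ih' h')
      exact ⟨_, .inst hΦ h₁ h₁', .beta h₂ h₂'⟩
    | beta h h' =>
      obtain ⟨⟨v, h₁, h₂⟩, ⟨v', h₁', h₂'⟩⟩ := And.intro (ih h) (ih' h')
      exact ⟨_, .inst hΦ h₁ h₁', .inst hΦ h₂ h₂'⟩
  | cbeta _ hl ih =>
    cases hu with
    | capp h h' =>
      obtain ⟨_, rfl, k⟩ := h.clam_inv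
      obtain ⟨v, h₁, h₂⟩ := ih k
      exact ⟨_, .cinst hΦ h₁ (.refl _), .cbeta h₂ (h'.symm.trans hl)⟩
    | cbeta h h' =>
      obtain ⟨v, h₁, h₂⟩ := ih h
      exact ⟨_, .cinst hΦ h₁ (.refl _), .cinst hΦ h₂ (h'.symm.trans hl)⟩
  | tm_univ hl =>
    cases hu with
    | app h h' =>
      obtain ⟨_, rfl⟩ := h.tm_head_inv
      obtain ⟨_, rfl, k⟩ := h'.univ_inv
      exact ⟨_, .refl _, .tm_univ (k.symm.trans hl)⟩
    | tm_univ h => exact ⟨_, .refl _, .capp (.refl _) (h.symm.trans hl)⟩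
  | app_abs _ _ ih ih' =>
    cases hu with
    | app h h' =>
      obtain ⟨_, _, _, _, _, rfl, k⟩ := h.app_head_inv
      obtain ⟨_, _, _, _, _, rfl, -, -, -, -, m⟩ := k.abs_inv
      obtain ⟨⟨v, h₁, h₂⟩, ⟨v', h₁', h₂'⟩⟩ := And.intro (ih m) (ih' h')
      exact ⟨_, .app h₁ h₁', .app_abs h₂ h₂'⟩
    | app_abs h h' =>
      obtain ⟨⟨v, h₁, h₂⟩, ⟨v', h₁', h₂'⟩⟩ := And.intro (ih h) (ih' h')
      exact ⟨_, .app h₁ h₁', .app h₂ h₂'⟩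
  | delta h =>
    cases hu with
    | const => exact ⟨_, .refl _, .delta h⟩
    | delta h' => cases hΦ.body_unique h h'; exact ⟨_, .refl _, .refl _⟩

/-! ### Confluence and injectivity -/

theorem Conv.join {t u : Term} (h : Conv Φ t u) :
    ∃ v, Relation.ReflTransGen (Par Φ) t v ∧ Relation.ReflTransGen (Par Φ) u v := by
  have heq : Equivalence (Relation.Join (Relation.ReflTransGen (Par Φ))) :=
    Relation.equivalence_join_reflTransGen fun a b c hb hc =>
      let ⟨d, h₁, h₂⟩ := hb.diamond hΦ hc
      ⟨d, .single h₁, .single h₂⟩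
  induction h with
  | rel _ _ h => exact ⟨_, .single (h.elim .of_step .of_termEq), .refl⟩
  | refl => exact heq.refl _
  | symm _ _ _ ih => exact heq.symm ih
  | trans _ _ _ _ _ ih ih' => exact heq.trans ih ih'

theorem Conv.subst {t u : Term} (h : Conv Φ t u) (σ : ℕ → Term) (θ : LevelSubst) :
    Conv Φ (t.subst σ θ) (u.subst σ θ) := by
  induction h with
  | rel _ _ h =>
    exact (Par.subst hΦ (h.elim .of_step .of_termEq) (fun _ => .refl _) fun _ => .refl _).conv
  | refl => exact .refl _
  | symm _ _ _ ih => exact ih.symm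
  | trans _ _ _ _ _ ih ih' => exact ih.trans ih'

theorem Conv.rename {t u : Term} (h : Conv Φ t u) (ρ ξ : ℕ → ℕ) :
    Conv Φ (t.rename ρ ξ) (u.rename ρ ξ) := by
  rw [Term.rename_eq_subst, Term.rename_eq_subst]; exact h.subst hΦ _ _

theorem Conv.inst {B B' u u' : Term} (h : Conv Φ B B') (hu : Conv Φ u u') :
    Conv Φ (B.inst u) (B'.inst u') := by
  have h₁ : Conv Φ (B.inst u) (B'.inst u) := by
    rw [Term.inst_eq, Term.inst_eq]; exact h.subst hΦ _ _
  refine h₁.trans ?_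
  clear h₁
  induction hu with
  | rel _ _ h => exact (Par.inst hΦ (.refl _) (h.elim .of_step .of_termEq)).conv
  | refl => exact .refl _
  | symm _ _ _ ih => exact ih.symm
  | trans _ _ _ _ _ ih ih' => exact ih.trans ih'

theorem Conv.cinst {B B' : Term} (h : Conv Φ B B') (l : Level) :
    Conv Φ (B.cinst l) (B'.cinst l) := by
  rw [Term.cinst_eq, Term.cinst_eq]; exact h.subst hΦ _ _

omit hΦ in
theorem Pars.pi_inv {A B u : Term} (h : Relation.ReflTransGen (Par Φ) (.pi A B) u) :
    ∃ A' B', u = .pi A' B' ∧ Conv Φ A A' ∧ Conv Φ B B' := by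
  induction h with
  | refl => exact ⟨_, _, rfl, .refl _, .refl _⟩
  | tail _ h ih =>
    obtain ⟨_, _, rfl, hA, hB⟩ := ih
    cases h with | pi h h' => exact ⟨_, _, rfl, hA.trans h.conv, hB.trans h'.conv⟩

omit hΦ in
theorem Pars.cpi_inv {A B u : Term} (h : Relation.ReflTransGen (Par Φ) (.cpi A B) u) :
    ∃ A' B', u = .cpi A' B' ∧ Conv Φ A A' ∧ Conv Φ B B' := by
  induction h with
  | refl => exact ⟨_, _, rfl, .refl _, .refl _⟩
  | tail _ h ih =>
    obtain ⟨_, _, rfl, hA, hB⟩ := ih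
    cases h with | cpi h h' => exact ⟨_, _, rfl, hA.trans h.conv, hB.trans h'.conv⟩

omit hΦ in
theorem Pars.tm_prod_inv {m l l' : Level} {A B u : Term}
    (h : Relation.ReflTransGen (Par Φ) (Tm m (Prod l l' A B)) u) :
    ∃ m₁ l₁ l₁' A₁ B₁, u = Tm m₁ (Prod l₁ l₁' A₁ B₁) ∧ LevelEq m m₁ ∧ LevelEq l l₁ ∧
      LevelEq l' l₁' ∧ Conv Φ A A₁ ∧ Conv Φ B B₁ := by
  induction h with
  | refl => exact ⟨_, _, _, _, _, rfl, .refl _, .refl _, .refl _, .refl _, .refl _⟩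
  | tail _ h ih =>
    obtain ⟨_, _, _, _, _, rfl, hm, hl, hl', hA, hB⟩ := ih
    cases h with | app h h₁ => cases h with | capp h h₂ =>
    cases h; cases h₁ with | app h h₃ => cases h with | app h h₄ =>
    cases h with | capp h h₅ => cases h with | capp h h₆ =>
    cases h
    exact ⟨_, _, _, _, _, rfl, hm.trans h₂, hl.trans h₆, hl'.trans h₅, hA.trans h₄.conv,
      hB.trans h₃.conv⟩

theorem Conv.pi_inj {A B A' B' : Term} (h : Conv Φ (.pi A B) (.pi A' B')) :
    Conv Φ A A' ∧ Conv Φ B B' := by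
  obtain ⟨v, h, h'⟩ := h.join hΦ
  obtain ⟨_, _, rfl, h₁, h₂⟩ := Pars.pi_inv h
  obtain ⟨_, _, e, h₁', h₂'⟩ := Pars.pi_inv h'
  cases e
  exact ⟨h₁.trans h₁'.symm, h₂.trans h₂'.symm⟩

theorem Conv.cpi_inj {A B A' B' : Term} (h : Conv Φ (.cpi A B) (.cpi A' B')) :
    Conv Φ A A' ∧ Conv Φ B B' := by
  obtain ⟨v, h, h'⟩ := h.join hΦ
  obtain ⟨_, _, rfl, h₁, h₂⟩ := Pars.cpi_inv h
  obtain ⟨_, _, e, h₁', h₂'⟩ := Pars.cpi_inv h'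
  cases e
  exact ⟨h₁.trans h₁'.symm, h₂.trans h₂'.symm⟩

theorem Conv.tm_prod_inj {m l l' m₁ l₁ l₁' : Level} {A B A₁ B₁ : Term}
    (h : Conv Φ (Tm m (Prod l l' A B)) (Tm m₁ (Prod l₁ l₁' A₁ B₁))) :
    LevelEq l l₁ ∧ LevelEq l' l₁' ∧ Conv Φ A A₁ ∧ Conv Φ B B₁ := by
  obtain ⟨v, h, h'⟩ := h.join hΦ
  obtain ⟨_, _, _, _, _, rfl, -, h₁, h₂, h₃, h₄⟩ := Pars.tm_prod_inv h
  obtain ⟨_, _, _, _, _, e, -, h₁', h₂', h₃', h₄'⟩ := Pars.tm_prod_inv h'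
  cases e
  exact ⟨h₁.trans h₁'.symm, h₂.trans h₂'.symm, h₃.trans h₃'.symm, h₄.trans h₄'.symm⟩

/-! ### Stability of reduction under level substitutions -/

theorem Step.subst {t u : Term} (h : Step Φ t u) (σ : ℕ → Term) (θ : LevelSubst) :
    Step Φ (t.subst σ θ) (u.subst σ θ) := by
  induction h generalizing σ θ with
  | root h =>
    refine .root ?_
    cases h with
    | beta t u => rw [Term.inst_subst]; exact .beta _ _
    | cbeta t l => rw [Term.cinst_subst]; exact .cbeta _ _
    | tm_univ => exact .tm_univ _ _
    | app_abs => exact .app_abs ..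
    | delta h => rw [hΦ.body_closed h]; exact .delta h
  | pi_left _ ih => exact .pi_left (ih ..)
  | pi_right _ ih => exact .pi_right (ih ..)
  | lam _ ih => exact .lam (ih ..)
  | app_left _ ih => exact .app_left (ih ..)
  | app_right _ ih => exact .app_right (ih ..)
  | cpi_left _ ih => exact .cpi_left (ih ..)
  | cpi_right _ ih => exact .cpi_right (ih ..)
  | clam _ ih => exact .clam (ih ..)
  | capp _ ih => exact .capp (ih ..)

theorem Steps.subst {t u : Term} (h : Steps Φ t u) (σ : ℕ → Term) (θ : LevelSubst) :
    Steps Φ (t.subst σ θ) (u.subst σ θ) := by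
  induction h with
  | refl => exact .refl
  | tail _ h ih => exact ih.tail (h.subst hΦ σ θ)

end Par

/-! ### Typing: renaming and substitution -/

mutual

theorem HasType.wfCtx {Φ Γ t A} : HasType Φ Γ t A → WfCtx Φ Γ
  | .sort h | .var h _ | .const h _ => h
  | .conv h _ _ | .pi h _ | .cpi h _ | .lam h _ _ | .clam h _ _ | .app h _ | .capp h _ => h.wfCtx

theorem HasCType.wfCtx {Φ Γ l A} : HasCType Φ Γ l A → WfCtx Φ Γ
  | .var h _ | .zero h => h
  | .succ h | .max h _ | .conv h _ _ => h.wfCtx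

end

mutual

/-- The variables of a typed term are declared in its context. -/
theorem HasType.subst_eq {Φ Γ t A} : HasType Φ Γ t A → ∀ {σ : ℕ → Term} {θ : LevelSubst},
    (∀ x B, Lookup Γ x B → σ x = .var x) → (∀ i B, CLookup Γ i B → θ i = .var i) →
    t.subst σ θ = t
  | .sort _, _, _, _, _ | .const _ _, _, _, _, _ => rfl
  | .var _ h, _, _, hσ, _ => hσ _ _ h
  | .conv h _ _, _, _, hσ, hθ => h.subst_eq hσ hθ
  | .pi hA hB, σ, θ, hσ, hθ => by
    rw [Term.subst, hA.subst_eq hσ hθ, hB.subst_eq]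
    · rintro _ _ (_ | h | _)
      · rfl
      · simp [upSubst, hσ _ _ h, Term.shift, Term.rename]
    · rintro _ _ (_ | _ | h)
      exact hθ _ _ h
  | .lam _ _ ht, σ, θ, hσ, hθ => by
    rw [Term.subst, ht.subst_eq]
    · rintro _ _ (_ | h | _)
      · rfl
      · simp [upSubst, hσ _ _ h, Term.shift, Term.rename]
    · rintro _ _ (_ | _ | h)
      exact hθ _ _ h
  | .cpi hA hB, σ, θ, hσ, hθ => by
    rw [Term.subst, hA.subst_eq hσ hθ, hB.subst_eq]
    · rintro _ _ (_ | _ | h)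
      simp [hσ _ _ h, Term.cshift, Term.rename]
    · rintro _ _ (_ | h | _)
      · rfl
      · simp [LevelSubst.up, hθ _ _ h, Level.rename, Level.subst]
  | .clam _ _ ht, σ, θ, hσ, hθ => by
    rw [Term.subst, ht.subst_eq]
    · rintro _ _ (_ | _ | h)
      simp [hσ _ _ h, Term.cshift, Term.rename]
    · rintro _ _ (_ | h | _)
      · rfl
      · simp [LevelSubst.up, hθ _ _ h, Level.rename, Level.subst]
  | .app ht hu, _, _, hσ, hθ => by rw [Term.subst, ht.subst_eq hσ hθ, hu.subst_eq hσ hθ]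
  | .capp ht hl, _, _, hσ, hθ => by rw [Term.subst, ht.subst_eq hσ hθ, hl.subst_eq hθ]

theorem HasCType.subst_eq {Φ Γ l A} : HasCType Φ Γ l A → ∀ {θ : LevelSubst},
    (∀ i B, CLookup Γ i B → θ i = .var i) → l.subst θ = l
  | .var _ h, _, hθ => hθ _ _ h
  | .zero _, _, _ => rfl
  | .succ h, _, hθ => by rw [Level.subst, h.subst_eq hθ]
  | .max h h', _, hθ => by rw [Level.subst, h.subst_eq hθ, h'.subst_eq hθ]
  | .conv h _ _, _, hθ => h.subst_eq hθ

end

theorem HasType.closed {Φ t A} (h : HasType Φ [] t A) (σ : ℕ → Term) (θ : LevelSubst) :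
    t.subst σ θ = t :=
  h.subst_eq (fun _ _ h => nomatch h) (fun _ _ h => nomatch h)

/-- The properties of a well-formed local signature on which the metatheory depends. -/
structure SigOk (Φ : LocalSig) : Prop extends RedSig Φ where
  name_unique {e e' : Entry} : e ∈ Φ → e' ∈ Φ → e.name = e'.name → e = e'
  type_closed {e : Entry} : e ∈ Φ → ∀ σ θ, e.type.subst σ θ = e.type
  type_valid {e : Entry} : e ∈ Φ → e.type = .sort .kind ∨ ∃ s, HasType Φ [] e.type (.sort s)
  body_typed {c A t} : (⟨c, A, some t⟩ : Entry) ∈ Φ → HasType Φ [] t A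

section
variable {Φ : LocalSig}

theorem HasConst.closed (hΦ : SigOk Φ) {c A} (h : HasConst Φ c A) (σ : ℕ → Term)
    (θ : LevelSubst) : A.subst σ θ = A := by
  cases h with
  | user h => exact hΦ.type_closed h σ θ
  | _ => rfl

/-- `ρ`, `ξ` is a renaming from the context `Γ` to the context `Δ`. -/
structure RenTyped (ρ ξ : ℕ → ℕ) (Γ Δ : Ctx) : Prop where
  reg {x A} : Lookup Γ x A → Lookup Δ (ρ x) (A.rename ρ ξ)
  conf {i A} : CLookup Γ i A → CLookup Δ (ξ i) (A.rename ρ ξ)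

theorem RenTyped.up_reg {ρ ξ Γ Δ} (h : RenTyped ρ ξ Γ Δ) (A : Term) :
    RenTyped (upRen ρ) ξ (.reg A :: Γ) (.reg (A.rename ρ ξ) :: Δ) where
  reg := by
    rintro _ _ (_ | h' | _) <;> rw [Term.shift_rename]
    · exact .here
    · exact .reg (h.reg h')
  conf := by
    rintro _ _ (_ | _ | h')
    rw [Term.shift_rename]
    exact .reg (h.conf h')

theorem RenTyped.up_conf {ρ ξ Γ Δ} (h : RenTyped ρ ξ Γ Δ) (A : Term) :
    RenTyped ρ (upRen ξ) (.conf A :: Γ) (.conf (A.rename ρ ξ) :: Δ) where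
  reg := by
    rintro _ _ (_ | _ | h')
    rw [Term.cshift_rename]
    exact .conf (h.reg h')
  conf := by
    rintro _ _ (_ | h' | _) <;> rw [Term.cshift_rename]
    · exact .here
    · exact .conf (h.conf h')

mutual

theorem HasType.rename (hΦ : SigOk Φ) {Γ t A} : HasType Φ Γ t A → ∀ {ρ ξ Δ},
    RenTyped ρ ξ Γ Δ → WfCtx Φ Δ → HasType Φ Δ (t.rename ρ ξ) (A.rename ρ ξ)
  | .sort _, _, _, _, _, hΔ => .sort hΔ
  | .var _ h, _, _, _, hr, hΔ => .var hΔ (hr.reg h)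
  | .const _ h, _, _, _, _, hΔ => by
    rw [Term.rename_eq_subst _ _ A, h.closed hΦ]; exact .const hΔ h
  | .conv h h' hc, _, _, _, hr, hΔ =>
    .conv (h.rename hΦ hr hΔ) (h'.rename hΦ hr hΔ) (hc.rename hΦ.toRedSig _ _)
  | .pi hA hB, _, _, _, hr, hΔ =>
    have hA' := hA.rename hΦ hr hΔ
    .pi hA' (hB.rename hΦ (hr.up_reg _) (.reg hA'))
  | .cpi hA hB, _, _, _, hr, hΔ =>
    have hA' := hA.rename hΦ hr hΔ
    .cpi hA' (hB.rename hΦ (hr.up_conf _) (.conf hA'))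
  | .lam hA hB ht, _, _, _, hr, hΔ =>
    have hA' := hA.rename hΦ hr hΔ
    .lam hA' (hB.rename hΦ (hr.up_reg _) (.reg hA')) (ht.rename hΦ (hr.up_reg _) (.reg hA'))
  | .clam hA hB ht, _, _, _, hr, hΔ =>
    have hA' := hA.rename hΦ hr hΔ
    .clam hA' (hB.rename hΦ (hr.up_conf _) (.conf hA')) (ht.rename hΦ (hr.up_conf _) (.conf hA'))
  | .app ht hu, _, _, _, hr, hΔ => by
    rw [Term.inst_rename]; exact .app (ht.rename hΦ hr hΔ) (hu.rename hΦ hr hΔ)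
  | .capp ht hl, _, _, _, hr, hΔ => by
    rw [Term.cinst_rename]; exact .capp (ht.rename hΦ hr hΔ) (hl.rename hΦ hr hΔ)

theorem HasCType.rename (hΦ : SigOk Φ) {Γ l A} : HasCType Φ Γ l A → ∀ {ρ ξ Δ},
    RenTyped ρ ξ Γ Δ → WfCtx Φ Δ → HasCType Φ Δ (l.rename ξ) (A.rename ρ ξ)
  | .var _ h, _, _, _, hr, hΔ => .var hΔ (hr.conf h)
  | .zero _, _, _, _, _, hΔ => .zero hΔ
  | .succ h, _, _, _, hr, hΔ => .succ (h.rename hΦ hr hΔ)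
  | .max h h', _, _, _, hr, hΔ => .max (h.rename hΦ hr hΔ) (h'.rename hΦ hr hΔ)
  | .conv h h' hc, _, _, _, hr, hΔ =>
    .conv (h.rename hΦ hr hΔ) (h'.rename hΦ hr hΔ) (hc.rename hΦ.toRedSig _ _)

end

theorem RenTyped.shift (Γ : Ctx) (A : Term) : RenTyped Nat.succ id Γ (.reg A :: Γ) :=
  ⟨.reg, .reg⟩

theorem RenTyped.cshift (Γ : Ctx) (A : Term) : RenTyped id Nat.succ Γ (.conf A :: Γ) :=
  ⟨.conf, .conf⟩

/-- Closed judgments hold in every context. -/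
theorem HasType.of_nil (hΦ : SigOk Φ) {Γ t A} (h : HasType Φ [] t A) (hΓ : WfCtx Φ Γ)
    (hA : ∀ σ θ, A.subst σ θ = A) : HasType Φ Γ t A := by
  have := h.rename hΦ (ρ := id) (ξ := id) (Δ := Γ) ⟨nofun, nofun⟩ hΓ
  rwa [Term.rename_eq_subst, h.closed, Term.rename_eq_subst, hA] at this

/-- `σ`, `θ` is a substitution from the context `Γ` to the context `Δ`. -/
structure SubTyped (Φ : LocalSig) (σ : ℕ → Term) (θ : LevelSubst) (Γ Δ : Ctx) : Prop where
  reg {x A} : Lookup Γ x A → HasType Φ Δ (σ x) (A.subst σ θ)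
  conf {i A} : CLookup Γ i A → HasCType Φ Δ (θ i) (A.subst σ θ)

theorem SubTyped.up_reg (hΦ : SigOk Φ) {σ θ Γ Δ} (h : SubTyped Φ σ θ Γ Δ) {A : Term}
    (hA : HasType Φ Δ (A.subst σ θ) (.sort .type)) :
    SubTyped Φ (upSubst σ) θ (.reg A :: Γ) (.reg (A.subst σ θ) :: Δ) where
  reg := by
    rintro _ _ (_ | h' | _) <;> rw [Term.shift_subst]
    · exact .var (.reg hA) .here
    · exact (h.reg h').rename hΦ (.shift _ _) (.reg hA)
  conf := by
    rintro i _ (_ | _ | h')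
    rw [Term.shift_subst]
    have := (h.conf h').rename hΦ (.shift _ _) (.reg hA)
    rwa [Level.rename, show (fun i => Level.var (id i)) = Level.var from rfl,
      Level.subst_var] at this

theorem SubTyped.up_conf (hΦ : SigOk Φ) {σ θ Γ Δ} (h : SubTyped Φ σ θ Γ Δ) {A : Term}
    (hA : HasType Φ Δ (A.subst σ θ) (.sort .type)) :
    SubTyped Φ (fun x => (σ x).cshift) θ.up (.conf A :: Γ) (.conf (A.subst σ θ) :: Δ) where
  reg := by
    rintro _ _ (_ | _ | h')
    rw [Term.cshift_subst]
    exact (h.reg h').rename hΦ (.cshift _ _) (.conf hA)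
  conf := by
    rintro _ _ (_ | h' | _) <;> rw [Term.cshift_subst]
    · exact .var (.conf hA) .here
    · exact (h.conf h').rename hΦ (.cshift _ _) (.conf hA)

mutual

theorem HasType.subst (hΦ : SigOk Φ) {Γ t A} : HasType Φ Γ t A → ∀ {σ θ Δ},
    SubTyped Φ σ θ Γ Δ → WfCtx Φ Δ → HasType Φ Δ (t.subst σ θ) (A.subst σ θ)
  | .sort _, _, _, _, _, hΔ => .sort hΔ
  | .var _ h, _, _, _, hr, _ => hr.reg h
  | .const _ h, _, _, _, _, hΔ => by
    rw [h.closed hΦ]; exact .const hΔ h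
  | .conv h h' hc, _, _, _, hr, hΔ =>
    .conv (h.subst hΦ hr hΔ) (h'.subst hΦ hr hΔ) (hc.subst hΦ.toRedSig _ _)
  | .pi hA hB, _, _, _, hr, hΔ =>
    have hA' := hA.subst hΦ hr hΔ
    .pi hA' (hB.subst hΦ (hr.up_reg hΦ hA') (.reg hA'))
  | .cpi hA hB, _, _, _, hr, hΔ =>
    have hA' := hA.subst hΦ hr hΔ
    .cpi hA' (hB.subst hΦ (hr.up_conf hΦ hA') (.conf hA'))
  | .lam hA hB ht, _, _, _, hr, hΔ =>
    have hA' := hA.subst hΦ hr hΔ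
    .lam hA' (hB.subst hΦ (hr.up_reg hΦ hA') (.reg hA'))
      (ht.subst hΦ (hr.up_reg hΦ hA') (.reg hA'))
  | .clam hA hB ht, _, _, _, hr, hΔ =>
    have hA' := hA.subst hΦ hr hΔ
    .clam hA' (hB.subst hΦ (hr.up_conf hΦ hA') (.conf hA'))
      (ht.subst hΦ (hr.up_conf hΦ hA') (.conf hA'))
  | .app ht hu, _, _, _, hr, hΔ => by
    rw [Term.inst_subst]; exact .app (ht.subst hΦ hr hΔ) (hu.subst hΦ hr hΔ)
  | .capp ht hl, _, _, _, hr, hΔ => by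
    rw [Term.cinst_subst]; exact .capp (ht.subst hΦ hr hΔ) (hl.subst hΦ hr hΔ)

theorem HasCType.subst (hΦ : SigOk Φ) {Γ l A} : HasCType Φ Γ l A → ∀ {σ θ Δ},
    SubTyped Φ σ θ Γ Δ → WfCtx Φ Δ → HasCType Φ Δ (l.subst θ) (A.subst σ θ)
  | .var _ h, _, _, _, hr, _ => hr.conf h
  | .zero _, _, _, _, _, hΔ => .zero hΔ
  | .succ h, _, _, _, hr, hΔ => .succ (h.subst hΦ hr hΔ)
  | .max h h', _, _, _, hr, hΔ => .max (h.subst hΦ hr hΔ) (h'.subst hΦ hr hΔ)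
  | .conv h h' hc, _, _, _, hr, hΔ =>
    .conv (h.subst hΦ hr hΔ) (h'.subst hΦ hr hΔ) (hc.subst hΦ.toRedSig _ _)

end

theorem HasType.inst (hΦ : SigOk Φ) {Γ A t B u} (h : HasType Φ (.reg A :: Γ) t B)
    (hu : HasType Φ Γ u A) : HasType Φ Γ (t.inst u) (B.inst u) := by
  rw [Term.inst_eq, Term.inst_eq]
  refine h.subst hΦ ⟨?_, ?_⟩ hu.wfCtx
  · rintro _ _ (_ | h' | _) <;> rw [← Term.inst_eq, Term.shift_inst]
    · exact hu
    · exact .var hu.wfCtx h'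
  · rintro _ _ (_ | _ | h')
    rw [← Term.inst_eq, Term.shift_inst]
    exact .var hu.wfCtx h'

theorem HasType.cinst (hΦ : SigOk Φ) {Γ A t B l} (h : HasType Φ (.conf A :: Γ) t B)
    (hl : HasCType Φ Γ l A) : HasType Φ Γ (t.cinst l) (B.cinst l) := by
  rw [Term.cinst_eq, Term.cinst_eq]
  refine h.subst hΦ ⟨?_, ?_⟩ hl.wfCtx
  · rintro _ _ (_ | _ | h')
    rw [← Term.cinst_eq, Term.cshift_cinst]
    exact .var hl.wfCtx h'
  · rintro _ _ (_ | h' | _) <;> rw [← Term.cinst_eq, Term.cshift_cinst]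
    · exact hl
    · exact .var hl.wfCtx h'

theorem HasType.conv_reg (hΦ : SigOk Φ) {Γ A A' t B} (h : HasType Φ (.reg A :: Γ) t B)
    (hA : HasType Φ Γ A (.sort .type)) (hA' : HasType Φ Γ A' (.sort .type)) (hc : Conv Φ A A') :
    HasType Φ (.reg A' :: Γ) t B := by
  have := h.subst hΦ (σ := .var) (θ := .var) (Δ := .reg A' :: Γ) ⟨?_, ?_⟩ (.reg hA')
  · simpa using this
  · rintro _ _ (_ | h' | _) <;> rw [Term.subst_var]
    · exact .conv (.var (.reg hA') .here) (hA.rename hΦ (.shift _ _) (.reg hA'))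
        (hc.symm.rename hΦ.toRedSig _ _)
    · exact .var (.reg hA') (.reg h')
  · rintro _ _ (_ | _ | h')
    rw [Term.subst_var]
    exact .var (.reg hA') (.reg h')

theorem HasType.conv_conf (hΦ : SigOk Φ) {Γ A A' t B} (h : HasType Φ (.conf A :: Γ) t B)
    (hA : HasType Φ Γ A (.sort .type)) (hA' : HasType Φ Γ A' (.sort .type)) (hc : Conv Φ A A') :
    HasType Φ (.conf A' :: Γ) t B := by
  have := h.subst hΦ (σ := .var) (θ := .var) (Δ := .conf A' :: Γ) ⟨?_, ?_⟩ (.conf hA')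
  · simpa using this
  · rintro _ _ (_ | _ | h')
    rw [Term.subst_var]
    exact .var (.conf hA') (.conf h')
  · rintro _ _ (_ | h' | _) <;> rw [Term.subst_var]
    · exact .conv (.var (.conf hA') .here) (hA.rename hΦ (.cshift _ _) (.conf hA'))
        (hc.symm.rename hΦ.toRedSig _ _)
    · exact .var (.conf hA') (.conf h')

/-! ### Inversion -/

/-- Typing derivations whose last rule is not the conversion rule. -/
inductive HasTypeDirect (Φ : LocalSig) : Ctx → Term → Term → Prop
  | sort {Γ} : HasTypeDirect Φ Γ (.sort .type) (.sort .kind)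
  | var {Γ x A} : Lookup Γ x A → HasTypeDirect Φ Γ (.var x) A
  | const {Γ c A} : HasConst Φ c A → HasTypeDirect Φ Γ (.const c) A
  | pi {Γ A B s} : HasType Φ Γ A (.sort .type) → HasType Φ (.reg A :: Γ) B (.sort s) →
      HasTypeDirect Φ Γ (.pi A B) (.sort s)
  | cpi {Γ A B s} : HasType Φ Γ A (.sort .type) → HasType Φ (.conf A :: Γ) B (.sort s) →
      HasTypeDirect Φ Γ (.cpi A B) (.sort s)
  | lam {Γ A B t s} : HasType Φ Γ A (.sort .type) → HasType Φ (.reg A :: Γ) B (.sort s) →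
      HasType Φ (.reg A :: Γ) t B → HasTypeDirect Φ Γ (.lam t) (.pi A B)
  | clam {Γ A B t s} : HasType Φ Γ A (.sort .type) → HasType Φ (.conf A :: Γ) B (.sort s) →
      HasType Φ (.conf A :: Γ) t B → HasTypeDirect Φ Γ (.clam t) (.cpi A B)
  | app {Γ A B t u} : HasType Φ Γ t (.pi A B) → HasType Φ Γ u A →
      HasTypeDirect Φ Γ (.app t u) (B.inst u)
  | capp {Γ A B t l} : HasType Φ Γ t (.cpi A B) → HasCType Φ Γ l A →
      HasTypeDirect Φ Γ (.capp t l) (B.cinst l)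

theorem HasType.direct {Γ t T} : HasType Φ Γ t T → ∃ T₀, HasTypeDirect Φ Γ t T₀ ∧ Conv Φ T₀ T
  | .sort _ => ⟨_, .sort, .refl _⟩
  | .var _ h => ⟨_, .var h, .refl _⟩
  | .const _ h => ⟨_, .const h, .refl _⟩
  | .conv h _ hc => let ⟨_, h, hc'⟩ := h.direct; ⟨_, h, hc'.trans hc⟩
  | .pi hA hB => ⟨_, .pi hA hB, .refl _⟩
  | .cpi hA hB => ⟨_, .cpi hA hB, .refl _⟩
  | .lam hA hB ht => ⟨_, .lam hA hB ht, .refl _⟩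
  | .clam hA hB ht => ⟨_, .clam hA hB ht, .refl _⟩
  | .app ht hu => ⟨_, .app ht hu, .refl _⟩
  | .capp ht hl => ⟨_, .capp ht hl, .refl _⟩

theorem HasType.sort_inv {Γ s T} (h : HasType Φ Γ (.sort s) T) : s = .type := by
  obtain ⟨_, h, -⟩ := h.direct
  cases h; rfl

theorem HasType.pi_inv {Γ A B T} (h : HasType Φ Γ (.pi A B) T) :
    HasType Φ Γ A (.sort .type) ∧ ∃ s, HasType Φ (.reg A :: Γ) B (.sort s) := by
  obtain ⟨_, h, -⟩ := h.direct
  cases h with | pi hA hB => exact ⟨hA, _, hB⟩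

theorem HasType.cpi_inv {Γ A B T} (h : HasType Φ Γ (.cpi A B) T) :
    HasType Φ Γ A (.sort .type) ∧ ∃ s, HasType Φ (.conf A :: Γ) B (.sort s) := by
  obtain ⟨_, h, -⟩ := h.direct
  cases h with | cpi hA hB => exact ⟨hA, _, hB⟩

theorem HasType.lam_inv {Γ t T} (h : HasType Φ Γ (.lam t) T) :
    ∃ A B, HasType Φ Γ A (.sort .type) ∧ HasType Φ (.reg A :: Γ) t B ∧ Conv Φ (.pi A B) T := by
  obtain ⟨_, h, hc⟩ := h.direct
  cases h with | lam hA _ ht => exact ⟨_, _, hA, ht, hc⟩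

theorem HasType.clam_inv {Γ t T} (h : HasType Φ Γ (.clam t) T) :
    ∃ A B, HasType Φ Γ A (.sort .type) ∧ HasType Φ (.conf A :: Γ) t B ∧
      Conv Φ (.cpi A B) T := by
  obtain ⟨_, h, hc⟩ := h.direct
  cases h with | clam hA _ ht => exact ⟨_, _, hA, ht, hc⟩

theorem HasType.const_inv {Γ c T} (h : HasType Φ Γ (.const c) T) :
    ∃ A, HasConst Φ c A ∧ Conv Φ A T := by
  obtain ⟨_, h, hc⟩ := h.direct
  cases h with | const h => exact ⟨_, h, hc⟩

theorem HasType.app_inv {Γ t u T} (h : HasType Φ Γ (.app t u) T) :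
    ∃ A B, HasType Φ Γ t (.pi A B) ∧ HasType Φ Γ u A ∧ Conv Φ (B.inst u) T := by
  obtain ⟨_, h, hc⟩ := h.direct
  cases h with | app ht hu => exact ⟨_, _, ht, hu, hc⟩

theorem HasType.capp_inv {Γ t l T} (h : HasType Φ Γ (.capp t l) T) :
    ∃ A B, HasType Φ Γ t (.cpi A B) ∧ HasCType Φ Γ l A ∧ Conv Φ (B.cinst l) T := by
  obtain ⟨_, h, hc⟩ := h.direct
  cases h with | capp ht hl => exact ⟨_, _, ht, hl, hc⟩

end

/-! ### Types of the constants -/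

section
variable {Φ : LocalSig}

@[simp] theorem Term.shift_subst_single (t u : Term) : t.shift.subst (single u) .var = t := by
  rw [← inst_eq, shift_inst]

@[simp] theorem single_zero (u : Term) : Term.single u 0 = u := rfl
@[simp] theorem upSubst_zero (σ : ℕ → Term) : upSubst σ 0 = .var 0 := rfl
@[simp] theorem upSubst_succ (σ : ℕ → Term) (n : ℕ) : upSubst σ (n + 1) = (σ n).shift := rfl

theorem HasType.capp₂ {Γ t X l l'} (h : HasType Φ Γ t (.cpi Lvl (.cpi Lvl X)))
    (hl : HasCType Φ Γ l Lvl) (hl' : HasCType Φ Γ l' Lvl) :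
    HasType Φ Γ (.capp (.capp t l) l') (X.subst .var (l'.cons (l.cons .var))) := by
  rw [← Term.subst_up_cinst]
  exact .capp (A := Lvl) (.capp h hl) hl'

theorem HasType.lvl {Γ} (hΓ : WfCtx Φ Γ) : HasType Φ Γ Lvl (.sort .type) := .const hΓ .lvl

theorem HasType.ty {Γ l} (hl : HasCType Φ Γ l Lvl) : HasType Φ Γ (Ty l) (.sort .type) :=
  .capp (.const hl.wfCtx .ty) hl

theorem HasType.tm {Γ l A} (hl : HasCType Φ Γ l Lvl) (hA : HasType Φ Γ A (Ty l)) :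
    HasType Φ Γ (Tm l A) (.sort .type) :=
  .app (.capp (.const hl.wfCtx .tm) hl) hA

theorem HasType.prod {Γ l l' A B} (hl : HasCType Φ Γ l Lvl) (hl' : HasCType Φ Γ l' Lvl)
    (hA : HasType Φ Γ A (Ty l)) (hB : HasType Φ Γ B (.pi (Tm l A) (Ty l'))) :
    HasType Φ Γ (Prod l l' A B) (Ty (.max l l')) := by
  have h₀ : HasType Φ Γ (.capp (.capp (.const .prod) l) l')
      (.pi (Ty l) (.pi (.pi (Tm l (.var 0)) (Ty l')) (Ty (.max l l')))) :=
    .capp₂ (.const hl.wfCtx .prod) hl hl'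
  have h₁ : HasType Φ Γ (.app (.capp (.capp (.const .prod) l) l') A)
      (.pi (.pi (Tm l A) (Ty l')) (Ty (.max l l'))) := by
    simpa [Term.inst_eq, Term.subst] using h₀.app hA
  simpa [Term.inst_eq, Term.subst] using h₁.app hB

theorem HasConst.valid (hΦ : SigOk Φ) {Γ c A} (hΓ : WfCtx Φ Γ) (h : HasConst Φ c A) :
    A = .sort .kind ∨ ∃ s, HasType Φ Γ A (.sort s) := by
  have h₁ : WfCtx Φ (.conf Lvl :: Γ) := .conf (.lvl hΓ)
  have h₂ : WfCtx Φ (.conf Lvl :: .conf Lvl :: Γ) := .conf (.lvl h₁)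
  have hA : HasType Φ (.conf Lvl :: .conf Lvl :: Γ) (Ty (.var 1)) (.sort .type) :=
    .ty (.var h₂ (.conf .here))
  have h₃ := WfCtx.reg hA
  have hT : HasType Φ (.reg (Ty (.var 1)) :: .conf Lvl :: .conf Lvl :: Γ)
      (Tm (.var 1) (.var 0)) (.sort .type) :=
    .tm (.var h₃ (.reg (.conf .here))) (.var h₃ .here)
  have h₄ := WfCtx.reg hT
  have hB := HasType.pi hT (.ty (.var h₄ (.reg (.reg .here))))
  have h₅ := WfCtx.reg hB
  have l₁ := HasCType.var h₅ (.reg (.reg (.conf .here)))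
  have l₀ := HasCType.var h₅ (.reg (.reg .here))
  have vA := HasType.var h₅ (.reg .here)
  have vB := HasType.var h₅ .here
  cases h with
  | lvl => exact .inr ⟨_, .sort hΓ⟩
  | ty => exact .inr ⟨_, .cpi (.lvl hΓ) (.sort h₁)⟩
  | tm =>
    have hA : HasType Φ (.conf Lvl :: Γ) (Ty (.var 0)) (.sort .type) := .ty (.var h₁ .here)
    exact .inr ⟨_, .cpi (.lvl hΓ) (.pi hA (.sort (.reg hA)))⟩
  | univ => exact .inr ⟨_, .cpi (.lvl hΓ) (.ty (.succ (.var h₁ .here)))⟩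
  | prod =>
    exact .inr ⟨_, .cpi (.lvl hΓ) (.cpi (.lvl h₁) (.pi hA (.pi hB (.ty (.max l₁ l₀)))))⟩
  | abs =>
    have hX := HasType.tm l₁ vA
    have h₆ := WfCtx.reg hX
    have hY := HasType.tm (.var h₆ (.reg (.reg (.reg .here))))
      (.app (.var h₆ (.reg .here)) (.var h₆ .here))
    have h₇ := WfCtx.reg (.pi hX hY)
    have k₁ := HasCType.var h₇ (.reg (.reg (.reg (.conf .here))))
    have k₀ := HasCType.var h₇ (.reg (.reg (.reg .here)))
    exact .inr ⟨_, .cpi (.lvl hΓ) (.cpi (.lvl h₁) (.pi hA (.pi hB (.pi (.pi hX hY)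
      (.tm (.max k₁ k₀) (.prod k₁ k₀ (.var h₇ (.reg (.reg .here)))
        (.var h₇ (.reg .here))))))))⟩
  | app =>
    have hX := HasType.tm (.max l₁ l₀) (.prod l₁ l₀ vA vB)
    have h₆ := WfCtx.reg hX
    have hY := HasType.tm (.var h₆ (.reg (.reg (.reg (.conf .here)))))
      (.var h₆ (.reg (.reg .here)))
    have h₇ := WfCtx.reg hY
    exact .inr ⟨_, .cpi (.lvl hΓ) (.cpi (.lvl h₁) (.pi hA (.pi hB (.pi hX (.pi hY
      (.tm (.var h₇ (.reg (.reg (.reg (.reg .here)))))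
        (.app (.var h₇ (.reg (.reg .here))) (.var h₇ .here))))))))⟩
  | user h =>
    exact (hΦ.type_valid h).imp id fun ⟨s, h⟩ => ⟨s, h.of_nil hΦ hΓ fun _ _ => rfl⟩

theorem HasConst.user_inv {n : ℕ} {A : Term} (h : HasConst Φ (.user n) A) :
    ∃ e ∈ Φ, e.name = n ∧ e.type = A := by
  generalize hc : Const.user n = c at h
  cases h <;> cases hc
  exact ⟨_, ‹_›, rfl, rfl⟩

theorem HasConst.unique (hΦ : SigOk Φ) {c A A'} (h : HasConst Φ c A) (h' : HasConst Φ c A') :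
    A = A' := by
  cases h with
  | user h =>
    obtain ⟨e, he, hn, rfl⟩ := h'.user_inv
    rw [hΦ.name_unique h he hn.symm]
  | _ => cases h'; rfl

/-! ### Validity of types -/

theorem Lookup.valid (hΦ : SigOk Φ) {Γ x A} (h : Lookup Γ x A) (hΓ : WfCtx Φ Γ) :
    HasType Φ Γ A (.sort .type) := by
  induction h with
  | here => cases hΓ with | reg h => exact h.rename hΦ (.shift _ _) (.reg h)
  | reg _ ih => cases hΓ with | reg h => exact (ih h.wfCtx).rename hΦ (.shift _ _) (.reg h)
  | conf _ ih => cases hΓ with | conf h => exact (ih h.wfCtx).rename hΦ (.cshift _ _) (.conf h)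

/-- The type of a typed term is `Kind` or is itself typed by a sort. -/
theorem HasType.valid (hΦ : SigOk Φ) {Γ t A} : HasType Φ Γ t A →
    A = .sort .kind ∨ ∃ s, HasType Φ Γ A (.sort s)
  | .sort _ => .inl rfl
  | .var hΓ h => .inr ⟨_, h.valid hΦ hΓ⟩
  | .const hΓ h => h.valid hΦ hΓ
  | .conv _ h _ => .inr ⟨_, h⟩
  | .pi (s := .kind) _ _ | .cpi (s := .kind) _ _ => .inl rfl
  | .pi (s := .type) h _ | .cpi (s := .type) h _ => .inr ⟨_, .sort h.wfCtx⟩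
  | .lam hA hB _ => .inr ⟨_, .pi hA hB⟩
  | .clam hA hB _ => .inr ⟨_, .cpi hA hB⟩
  | .app ht hu => by
    rcases ht.valid hΦ with e | ⟨_, h⟩
    · cases e
    · obtain ⟨_, s, h⟩ := h.pi_inv
      exact .inr ⟨s, h.inst hΦ hu⟩
  | .capp ht hl => by
    rcases ht.valid hΦ with e | ⟨_, h⟩
    · cases e
    · obtain ⟨_, s, h⟩ := h.cpi_inv
      exact .inr ⟨s, h.cinst hΦ hl⟩


theorem HasType.typed_of_pi (hΦ : SigOk Φ) {Γ t A B} (h : HasType Φ Γ t (.pi A B)) :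
    HasType Φ Γ A (.sort .type) := by
  rcases h.valid hΦ with e | ⟨_, h⟩
  · cases e
  · exact h.pi_inv.1

/-! ### Principal types -/

/-- `P` is, up to conversion, the only type of `t` in `Γ`. -/
structure Principal (Φ : LocalSig) (Γ : Ctx) (t P : Term) : Prop where
  typed : HasType Φ Γ t P
  conv {T} : HasType Φ Γ t T → Conv Φ P T

theorem Principal.const (hΦ : SigOk Φ) {Γ c A} (hΓ : WfCtx Φ Γ) (h : HasConst Φ c A) :
    Principal Φ Γ (.const c) A where
  typed := .const hΓ h
  conv h' := by
    obtain ⟨_, h', hc⟩ := h'.const_inv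
    rwa [h.unique hΦ h']

theorem Principal.capp (hΦ : SigOk Φ) {Γ t A B l T} (ht : Principal Φ Γ t (.cpi A B))
    (h : HasType Φ Γ (.capp t l) T) :
    HasCType Φ Γ l A ∧ Principal Φ Γ (.capp t l) (B.cinst l) := by
  have key : ∀ {T}, HasType Φ Γ (.capp t l) T →
      HasCType Φ Γ l A ∧ Conv Φ (B.cinst l) T := by
    intro T h
    obtain ⟨A', B', h, hl, hc⟩ := h.capp_inv
    obtain ⟨hA, hB⟩ := (ht.conv h).cpi_inj hΦ.toRedSig
    rcases ht.typed.valid hΦ with e | ⟨_, h⟩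
    · cases e
    · exact ⟨.conv hl h.cpi_inv.1 hA.symm, (hB.cinst hΦ.toRedSig l).trans hc⟩
  exact ⟨(key h).1, .capp ht.typed (key h).1, fun h => (key h).2⟩

theorem Principal.app (hΦ : SigOk Φ) {Γ t A B u T} (ht : Principal Φ Γ t (.pi A B))
    (h : HasType Φ Γ (.app t u) T) :
    HasType Φ Γ u A ∧ Principal Φ Γ (.app t u) (B.inst u) := by
  have key : ∀ {T}, HasType Φ Γ (.app t u) T →
      HasType Φ Γ u A ∧ Conv Φ (B.inst u) T := by
    intro T h
    obtain ⟨A', B', h, hu, hc⟩ := h.app_inv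
    obtain ⟨hA, hB⟩ := (ht.conv h).pi_inj hΦ.toRedSig
    exact ⟨.conv hu (ht.typed.typed_of_pi hΦ) hA.symm,
      (hB.inst hΦ.toRedSig (.refl u)).trans hc⟩
  exact ⟨(key h).1, .app ht.typed (key h).1, fun h => (key h).2⟩

theorem Principal.capp₂ (hΦ : SigOk Φ) {Γ t X l l' T}
    (ht : Principal Φ Γ t (.cpi Lvl (.cpi Lvl X))) (h : HasType Φ Γ (.capp (.capp t l) l') T) :
    HasCType Φ Γ l Lvl ∧ HasCType Φ Γ l' Lvl ∧
      Principal Φ Γ (.capp (.capp t l) l') (X.subst .var (l'.cons (l.cons .var))) := by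
  obtain ⟨_, _, h₀, -⟩ := h.capp_inv
  obtain ⟨hl, p⟩ := ht.capp hΦ h₀
  obtain ⟨hl', p⟩ := Principal.capp (A := Lvl) hΦ p h
  refine ⟨hl, hl', ?_⟩
  rw [← Term.subst_up_cinst]
  exact p

theorem HasType.abs_inv (hΦ : SigOk Φ) {Γ l l' A B t T} (h : HasType Φ Γ (Abs l l' A B t) T) :
    HasType Φ Γ t (.pi (Tm l A) (Tm l' (.app B.shift (.var 0)))) ∧
      Conv Φ (Tm (.max l l') (Prod l l' A B)) T := by
  obtain ⟨_, _, h₂, -⟩ := h.app_inv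
  obtain ⟨_, _, h₁, -⟩ := h₂.app_inv
  obtain ⟨_, _, h₀, -⟩ := h₁.app_inv
  obtain ⟨hl, hl', p⟩ := Principal.capp₂ hΦ (.const hΦ h.wfCtx .abs) h₀
  obtain ⟨hA, p⟩ := p.app hΦ h₁
  rw [Term.inst_eq] at p
  obtain ⟨hB, p⟩ := Principal.app hΦ p h₂
  rw [Term.inst_eq] at p
  obtain ⟨ht, p⟩ := Principal.app hΦ p h
  have hc := p.conv h
  simp only [Term.inst_eq, Term.subst, Level.subst, Level.cons, Term.shift_subst,
    Term.shift_subst_single, Level.subst_var, single_zero, upSubst_zero, upSubst_succ] at ht hc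
  exact ⟨ht, hc⟩

theorem HasType.app_app_inv (hΦ : SigOk Φ) {Γ l l' A B t u T}
    (h : HasType Φ Γ (App l l' A B t u) T) :
    HasType Φ Γ t (Tm (.max l l') (Prod l l' A B)) ∧ HasType Φ Γ u (Tm l A) ∧
      Conv Φ (Tm l' (.app B u)) T := by
  obtain ⟨_, _, h₃, -⟩ := h.app_inv
  obtain ⟨_, _, h₂, -⟩ := h₃.app_inv
  obtain ⟨_, _, h₁, -⟩ := h₂.app_inv
  obtain ⟨_, _, h₀, -⟩ := h₁.app_inv
  obtain ⟨hl, hl', p⟩ := Principal.capp₂ hΦ (.const hΦ h.wfCtx .app) h₀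
  obtain ⟨hA, p⟩ := p.app hΦ h₁
  rw [Term.inst_eq] at p
  obtain ⟨hB, p⟩ := Principal.app hΦ p h₂
  rw [Term.inst_eq] at p
  obtain ⟨ht, p⟩ := Principal.app hΦ p h₃
  rw [Term.inst_eq] at p
  obtain ⟨hu, p⟩ := Principal.app hΦ p h
  have hc := p.conv h
  simp only [Term.inst_eq, Term.subst, Level.subst, Level.cons, Term.shift_subst,
    Term.shift_subst_single, Level.subst_var, single_zero, upSubst_zero, upSubst_succ] at ht hu hc
  exact ⟨ht, hu, hc⟩

/-! ### Subject reduction -/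

theorem HasType.root (hΦ : SigOk Φ) {Γ t t' T s} (h : HasType Φ Γ t T)
    (hT : HasType Φ Γ T (.sort s)) (r : RootStep Φ t t') : HasType Φ Γ t' T := by
  cases r with
  | beta t u =>
    obtain ⟨A, B, h, hu, hc⟩ := h.app_inv
    obtain ⟨A', B', hA', ht, hc'⟩ := h.lam_inv
    obtain ⟨hA, hB⟩ := hc'.pi_inj hΦ.toRedSig
    exact .conv (ht.inst hΦ (.conv hu hA' hA.symm)) hT
      ((hB.inst hΦ.toRedSig (.refl u)).trans hc)
  | cbeta t l =>
    obtain ⟨A, B, h, hl, hc⟩ := h.capp_inv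
    obtain ⟨A', B', hA', ht, hc'⟩ := h.clam_inv
    obtain ⟨hA, hB⟩ := hc'.cpi_inj hΦ.toRedSig
    exact .conv (ht.cinst hΦ (.conv hl hA' hA.symm)) hT ((hB.cinst hΦ.toRedSig l).trans hc)
  | tm_univ l' l =>
    obtain ⟨_, _, h₁, hu, -⟩ := h.app_inv
    obtain ⟨_, p⟩ := (Principal.const hΦ h.wfCtx .tm).capp hΦ h₁
    obtain ⟨_, p⟩ := Principal.app hΦ p h
    obtain ⟨hl, -⟩ := (Principal.const hΦ h.wfCtx .univ).capp hΦ hu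
    exact .conv (.ty hl) hT (p.conv h)
  | app_abs l l' A B l'' l''' A' B' t u =>
    obtain ⟨ht, hu, hc⟩ := h.app_app_inv hΦ
    obtain ⟨ht, hc'⟩ := ht.abs_inv hΦ
    obtain ⟨hl, hl', hA, hB⟩ := hc'.tm_prod_inj hΦ.toRedSig
    refine .conv (.app ht (.conv hu (ht.typed_of_pi hΦ) ?_)) hT (.trans ?_ hc)
    · exact .app (.capp (.refl _) hl.symm) hA.symm
    · simp only [Term.inst_eq, Term.subst, Term.shift_subst_single, Level.subst_var, single_zero]
      exact .app (.capp (.refl _) hl') (.app hB (.refl _))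
  | delta h' =>
    obtain ⟨_, h, hc⟩ := h.const_inv
    cases h.unique hΦ (.user h')
    exact .conv ((hΦ.body_typed h').of_nil hΦ hT.wfCtx (hΦ.type_closed h')) hT hc

theorem HasType.step (hΦ : SigOk Φ) {Γ t T} : HasType Φ Γ t T → ∀ {t'}, Step Φ t t' →
    HasType Φ Γ t' T
  | .sort _, _, h => by cases h with | root h => cases h
  | .var _ _, _, h => by cases h with | root h => cases h
  | .const hΓ h', _, h => by
    cases h with
    | root h =>
      cases h with
      | delta h =>
        cases h'.unique hΦ (.user h)
        exact (hΦ.body_typed h).of_nil hΦ hΓ (hΦ.type_closed h)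
  | .conv h' hB hc, _, h => .conv (h'.step hΦ h) hB hc
  | .pi hA hB, _, h => by
    cases h with
    | root h => cases h
    | pi_left h =>
      have hA' := hA.step hΦ h
      exact .pi hA' (hB.conv_reg hΦ hA hA' (.step h))
    | pi_right h => exact .pi hA (hB.step hΦ h)
  | .cpi hA hB, _, h => by
    cases h with
    | root h => cases h
    | cpi_left h =>
      have hA' := hA.step hΦ h
      exact .cpi hA' (hB.conv_conf hΦ hA hA' (.step h))
    | cpi_right h => exact .cpi hA (hB.step hΦ h)
  | .lam hA hB ht, _, h => by
    cases h with
    | root h => cases h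
    | lam h => exact .lam hA hB (ht.step hΦ h)
  | .clam hA hB ht, _, h => by
    cases h with
    | root h => cases h
    | clam h => exact .clam hA hB (ht.step hΦ h)
  | .app (A := A) (B := B) (u := u) ht hu, _, h => by
    have hT : ∃ s, HasType Φ Γ (B.inst u) (.sort s) := by
      rcases ht.valid hΦ with e | ⟨_, h⟩
      · cases e
      · obtain ⟨_, s, h⟩ := h.pi_inv
        exact ⟨s, h.inst hΦ hu⟩
    obtain ⟨s, hT⟩ := hT
    cases h with
    | root h => exact (HasType.app ht hu).root hΦ hT h
    | app_left h => exact .app (ht.step hΦ h) hu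
    | app_right h =>
      exact .conv (.app ht (hu.step hΦ h)) hT (.inst hΦ.toRedSig (.refl _) (.symm (.step h)))
  | .capp (A := A) (B := B) (l := l) ht hl, _, h => by
    have hT : ∃ s, HasType Φ Γ (B.cinst l) (.sort s) := by
      rcases ht.valid hΦ with e | ⟨_, h⟩
      · cases e
      · obtain ⟨_, s, h⟩ := h.cpi_inv
        exact ⟨s, h.cinst hΦ hl⟩
    obtain ⟨s, hT⟩ := hT
    cases h with
    | root h => exact (HasType.capp ht hl).root hΦ hT h
    | capp h => exact .capp (ht.step hΦ h) hl

theorem HasType.steps (hΦ : SigOk Φ) {Γ t t' T} (h : HasType Φ Γ t T) (hs : Steps Φ t t') :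
    HasType Φ Γ t' T := by
  induction hs with
  | refl => exact h
  | tail _ hs ih => exact ih.step hΦ hs

end

/-! ### Well-formed signatures -/

section
variable {Φ Φ' : LocalSig}

theorem HasConst.mono (hs : Φ ⊆ Φ') {c A} (h : HasConst Φ c A) : HasConst Φ' c A := by
  cases h with
  | user h => exact .user (hs h)
  | _ => constructor

theorem Step.mono (hs : Φ ⊆ Φ') {t u} (h : Step Φ t u) : Step Φ' t u := by
  induction h with
  | root h =>
    refine .root ?_
    cases h with
    | delta h => exact .delta (hs h)
    | _ => constructor
  | pi_left _ ih => exact .pi_left ih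
  | pi_right _ ih => exact .pi_right ih
  | lam _ ih => exact .lam ih
  | app_left _ ih => exact .app_left ih
  | app_right _ ih => exact .app_right ih
  | cpi_left _ ih => exact .cpi_left ih
  | cpi_right _ ih => exact .cpi_right ih
  | clam _ ih => exact .clam ih
  | capp _ ih => exact .capp ih

theorem Conv.mono (hs : Φ ⊆ Φ') {t u} (h : Conv Φ t u) : Conv Φ' t u := by
  induction h with
  | rel _ _ h => exact .rel _ _ (h.imp (.mono hs) id)
  | refl => exact .refl _
  | symm _ _ _ ih => exact ih.symm
  | trans _ _ _ _ _ ih ih' => exact ih.trans ih'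

mutual

theorem WfCtx.mono (hs : Φ ⊆ Φ') {Γ} : WfCtx Φ Γ → WfCtx Φ' Γ
  | .nil => .nil
  | .reg h => .reg (h.mono hs)
  | .conf h => .conf (h.mono hs)

theorem HasType.mono (hs : Φ ⊆ Φ') {Γ t A} : HasType Φ Γ t A → HasType Φ' Γ t A
  | .sort h => .sort (h.mono hs)
  | .var h hx => .var (h.mono hs) hx
  | .const h hc => .const (h.mono hs) (hc.mono hs)
  | .conv h hB hc => .conv (h.mono hs) (hB.mono hs) (hc.mono hs)
  | .pi hA hB => .pi (hA.mono hs) (hB.mono hs)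
  | .cpi hA hB => .cpi (hA.mono hs) (hB.mono hs)
  | .lam hA hB ht => .lam (hA.mono hs) (hB.mono hs) (ht.mono hs)
  | .clam hA hB ht => .clam (hA.mono hs) (hB.mono hs) (ht.mono hs)
  | .app ht hu => .app (ht.mono hs) (hu.mono hs)
  | .capp ht hl => .capp (ht.mono hs) (hl.mono hs)

theorem HasCType.mono (hs : Φ ⊆ Φ') {Γ l A} : HasCType Φ Γ l A → HasCType Φ' Γ l A
  | .var h hi => .var (h.mono hs) hi
  | .zero h => .zero (h.mono hs)
  | .succ h => .succ (h.mono hs)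
  | .max h h' => .max (h.mono hs) (h'.mono hs)
  | .conv h hB hc => .conv (h.mono hs) (hB.mono hs) (hc.mono hs)

end

theorem SigOk.cons (hΦ : SigOk Φ) {e : Entry} (hf : Fresh e.name Φ)
    (ht : e.type = .sort .kind ∨ ∃ s, HasType Φ [] e.type (.sort s))
    (hb : ∀ t, e.body = some t → HasType Φ [] t e.type) : SigOk (e :: Φ) := by
  have hs : Φ ⊆ e :: Φ := List.subset_cons_self _ _
  have hu : ∀ {e₁ e₂ : Entry}, e₁ ∈ e :: Φ → e₂ ∈ e :: Φ → e₁.name = e₂.name → e₁ = e₂ := by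
    intro e₁ e₂ h₁ h₂ h
    rcases List.mem_cons.1 h₁ with rfl | k₁ <;> rcases List.mem_cons.1 h₂ with rfl | k₂
    · rfl
    · exact absurd h.symm (hf _ k₂)
    · exact absurd h (hf _ k₁)
    · exact hΦ.name_unique k₁ k₂ h
  have hbody : ∀ {c A t}, (⟨c, A, some t⟩ : Entry) ∈ e :: Φ → HasType Φ [] t A := by
    intro c A t h
    rcases List.mem_cons.1 h with rfl | h
    · exact hb t rfl
    · exact hΦ.body_typed h
  have htype : ∀ {e' : Entry}, e' ∈ e :: Φ →
      e'.type = .sort .kind ∨ ∃ s, HasType Φ [] e'.type (.sort s) := by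
    intro e' h
    rcases List.mem_cons.1 h with rfl | h
    · exact ht
    · exact hΦ.type_valid h
  exact
    { body_unique := fun h h' => by cases hu h h' rfl; rfl
      body_closed := fun h => (hbody h).closed
      name_unique := hu
      type_closed := fun h σ θ => by
        rcases htype h with e | ⟨_, h⟩
        · rw [e]; rfl
        · exact h.closed σ θ
      type_valid := fun h => (htype h).imp id fun ⟨s, h⟩ => ⟨s, h.mono hs⟩
      body_typed := fun h => (hbody h).mono hs }

theorem WfSig.sigOk (h : WfSig Φ) : SigOk Φ := by
  induction h with
  | nil =>
    exact ⟨⟨nofun, nofun⟩, nofun, nofun, nofun, nofun⟩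
  | decl _ hf h ih => exact ih.cons hf (.inr ⟨_, h⟩) nofun
  | defn _ hf h ih =>
    exact ih.cons hf (h.valid ih) fun t ht => by cases ht; exact h

/-! ### Soundness of the elaborator -/

mutual

theorem ConvGen.sound (hΦ : SigOk Φ) {A B C} : ConvGen Φ A B C → ∀ {θ}, Unifies θ C →
    Conv Φ (A.lsubst θ) (B.lsubst θ)
  | .mk hA hB h, θ, hθ =>
    ((Conv.steps (hA.1.subst hΦ.toRedSig .var θ)).trans (h.sound hΦ hθ)).trans
      (Conv.steps (hB.1.subst hΦ.toRedSig .var θ)).symm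

theorem ConvWhnf.sound (hΦ : SigOk Φ) {A B C} : ConvWhnf Φ A B C → ∀ {θ}, Unifies θ C →
    Conv Φ (A.lsubst θ) (B.lsubst θ)
  | .var _, _, _ | .const _, _, _ | .sort _, _, _ => .refl _
  | .lam h, θ, hθ => by
    have := h.sound hΦ hθ
    simp only [Term.lsubst, Term.subst, upSubst_var] at this ⊢
    exact .lam this
  | .pi h h', θ, hθ => by
    have h₁ := h.sound hΦ fun p hp => hθ p (.inl hp)
    have h₂ := h'.sound hΦ fun p hp => hθ p (.inr hp)
    simp only [Term.lsubst, Term.subst, upSubst_var] at h₁ h₂ ⊢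
    exact .pi h₁ h₂
  | .app h h', _, hθ =>
    .app (h.sound hΦ fun p hp => hθ p (.inl hp)) (h'.sound hΦ fun p hp => hθ p (.inr hp))
  | .capp h, _, hθ => .capp (h.sound hΦ fun p hp => hθ p (.inl hp)) (hθ _ (.inr rfl))

end

/-- The substitution `[j₁ … jₖ ↦ ls]` for the `k` innermost confined variables, followed by `η` on
the remaining ones. -/
def instLevelsThen (ls : List Level) (η : LevelSubst) : LevelSubst :=
  ls.foldl (fun η l => l.cons η) η

theorem instLevelsThen_apply (ls : List Level) (η : LevelSubst) (n : ℕ) :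
    instLevelsThen ls η n = (ls.reverse[n]?).getD (η (n - ls.length)) := by
  induction ls generalizing η with
  | nil => rfl
  | cons l ls ih =>
    rw [instLevelsThen, List.foldl_cons, ← instLevelsThen, ih, List.reverse_cons]
    rcases lt_trichotomy n ls.length with h | rfl | h
    · rw [List.getElem?_append_left (by simpa using h),
        List.getElem?_eq_getElem (by simpa using h)]
      rfl
    · simp [Level.cons]
    · obtain ⟨k, rfl⟩ := Nat.exists_eq_add_of_lt h
      rw [List.getElem?_eq_none (by simp; omega), List.getElem?_eq_none (by simp)]
      simp only [Option.getD_none, List.length_cons]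
      rw [show ls.length + k + 1 - ls.length = k + 1 by omega,
        show ls.length + k + 1 - (ls.length + 1) = k by omega]
      rfl

theorem HasType.capps {Γ t B} {ls : List Level} {η : LevelSubst}
    (h : HasType Φ Γ t ((lvlPis ls.length B).lsubst η)) (hls : ∀ l ∈ ls, HasCType Φ Γ l Lvl) :
    HasType Φ Γ (ls.foldl .capp t) (B.lsubst (instLevelsThen ls η)) := by
  induction ls generalizing t η with
  | nil => exact h
  | cons l ls ih =>
    refine ih (η := l.cons η) ?_ fun l hl => hls l (.tail _ hl)
    rw [Term.lsubst, ← Term.subst_up_cinst]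
    exact .capp h (hls l (.head _))

theorem lsubst_constApp (c : Const) (is : List ℕ) (θ : LevelSubst) :
    (constApp c is).lsubst θ = (is.map θ).foldl .capp (.const c) := by
  have key : ∀ t : Term, (is.foldl (fun t i => .capp t (.var i)) t).lsubst θ =
      (is.map θ).foldl .capp (t.lsubst θ) := by
    induction is with
    | nil => intro t; rfl
    | cons i is ih => intro t; exact ih _
  exact key _

theorem lsubst_instLevels (B : Term) (is : List ℕ) (θ : LevelSubst) :
    (B.lsubst (instLevels is)).lsubst θ = B.lsubst (instLevelsThen (is.map θ) θ) := by
  rw [Term.lsubst, Term.lsubst, Term.subst_subst]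
  refine congrArg (B.subst .var) (funext fun n => ?_)
  rw [instLevelsThen_apply, ← List.map_reverse, List.getElem?_map, instLevels, List.length_map]
  cases is.reverse[n]? <;> rfl

theorem Term.shift_lsubst (A : Term) (θ : LevelSubst) : A.shift.lsubst θ = (A.lsubst θ).shift := by
  rw [lsubst, lsubst, ← shift_subst, upSubst_var]

/-- The context `Δ` contains the regular variables of `Γ`, with their types instantiated by `θ`,
and types the levels in the image of `θ`. -/
structure CtxInst (Φ : LocalSig) (θ : LevelSubst) (Γ Δ : Ctx) : Prop where
  wf : WfCtx Φ Δ
  lookup {x A} : Lookup Γ x A → Lookup Δ x (A.lsubst θ)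
  level i : HasCType Φ Δ (θ i) Lvl

theorem CtxInst.cons (hΦ : SigOk Φ) {θ Γ Δ} (h : CtxInst Φ θ Γ Δ) {A : Term}
    (hA : HasType Φ Δ (A.lsubst θ) (.sort .type)) :
    CtxInst Φ θ (.reg A :: Γ) (.reg (A.lsubst θ) :: Δ) where
  wf := .reg hA
  lookup := by
    rintro _ _ (_ | h' | _) <;> rw [Term.shift_lsubst]
    · exact .here
    · exact .reg (h.lookup h')
  level i := by
    have := (h.level i).rename hΦ (.shift _ _) (.reg hA)
    rwa [Level.rename, show (fun i => Level.var (id i)) = Level.var from rfl,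
      Level.subst_var] at this

/-- A reduct of a type of a term, if it is not `Kind`, is typed by a sort. -/
theorem HasType.valid_steps (hΦ : SigOk Φ) {Γ t T T'} (h : HasType Φ Γ t T) (hs : Steps Φ T T') :
    T' = .sort .kind ∨ ∃ s, HasType Φ Γ T' (.sort s) := by
  rcases h.valid hΦ with rfl | ⟨s, h⟩
  · left
    induction hs with
    | refl => rfl
    | tail _ hs ih =>
      subst ih
      cases hs with | root h => cases h
  · exact .inr ⟨s, h.steps hΦ hs⟩

theorem Term.lsubst_pi (A B : Term) (θ : LevelSubst) :
    (Term.pi A B).lsubst θ = .pi (A.lsubst θ) (B.lsubst θ) := by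
  simp [lsubst, subst]

theorem Term.lsubst_lam (t : Term) (θ : LevelSubst) :
    (Term.lam t).lsubst θ = .lam (t.lsubst θ) := by
  simp [lsubst, subst]

theorem Term.lsubst_inst (B u : Term) (θ : LevelSubst) :
    (B.inst u).lsubst θ = (B.lsubst θ).inst (u.lsubst θ) := by
  simp [lsubst, inst_subst]

mutual

theorem Check.sound (hΦ : SigOk Φ) {Γ D t T C} : Check Φ Γ D t T C → ∀ {θ Δ s},
    CtxInst Φ θ Γ Δ → Unifies θ C → HasType Φ Δ (T.lsubst θ) (.sort s) →
    HasType Φ Δ (t.lsubst θ) (T.lsubst θ)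
  | .switch h hc, _, _, _, hΔ, hθ, hT =>
    .conv (h.sound hΦ hΔ fun p hp => hθ p (.inl hp)) hT
      (hc.sound hΦ fun p hp => hθ p (.inr hp))
  | .lam hr h, θ, Δ, s, hΔ, hθ, hT => by
    have hr := hr.1.subst hΦ.toRedSig .var θ
    have hp := hT.steps hΦ hr
    rw [← Term.lsubst, Term.lsubst_pi] at hp
    obtain ⟨hA, s', hB⟩ := hp.pi_inv
    rw [Term.lsubst_lam]
    refine .conv (.lam hA hB (h.sound hΦ (hΔ.cons hΦ hA) hθ hB)) hT ?_
    rw [← Term.lsubst_pi]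
    exact (Conv.steps hr).symm

theorem Infer.sound (hΦ : SigOk Φ) {Γ D t T C} : Infer Φ Γ D t T C → ∀ {θ Δ},
    CtxInst Φ θ Γ Δ → Unifies θ C → HasType Φ Δ (t.lsubst θ) (T.lsubst θ)
  | .var h, _, _, hΔ, _ => .var hΔ.wf (hΔ.lookup h)
  | .const (c := c) (B := B) (is := is) h, θ, Δ, hΔ, _ => by
    rw [lsubst_constApp, lsubst_instLevels]
    refine HasType.capps ?_ ?_
    · rw [List.length_map, Term.lsubst, h.closed hΦ]
      exact .const hΔ.wf h
    · simp only [List.mem_map]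
      rintro _ ⟨i, -, rfl⟩
      exact hΔ.level i
  | .sort, _, _, hΔ, _ => .sort hΔ.wf
  | .pi (s := s) hA hB hr, θ, Δ, hΔ, hθ => by
    have hA := hA.sound hΦ hΔ (fun p hp => hθ p (.inl hp)) (.sort hΔ.wf)
    have hΔ' := hΔ.cons hΦ hA
    have hB := hB.sound hΦ hΔ' fun p hp => hθ p (.inr hp)
    have hr := hr.1.subst hΦ.toRedSig .var θ
    rw [Term.lsubst_pi]
    cases s with
    | type => exact .pi hA (.conv hB (.sort hΔ'.wf) (.steps hr))
    | kind =>
      rcases hB.valid hΦ with e | ⟨_, h⟩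
      · rw [e] at hB
        exact .pi hA hB
      · cases (h.steps hΦ hr).sort_inv
  | .app h hr hu, θ, Δ, hΔ, hθ => by
    have ht := h.sound hΦ hΔ fun p hp => hθ p (.inl hp)
    have hr := hr.1.subst hΦ.toRedSig .var θ
    have hv := ht.valid_steps hΦ hr
    rw [← Term.lsubst, Term.lsubst_pi] at hv
    rcases hv with e | ⟨_, hp⟩
    · cases e
    · have hc := Conv.steps hr
      rw [← Term.lsubst, ← Term.lsubst, Term.lsubst_pi] at hc
      rw [Term.lsubst_inst]
      exact .app (.conv ht hp hc)
        (hu.sound hΦ hΔ (fun p hp => hθ p (.inr hp)) hp.pi_inv.1)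

end

/-! ### Generalization -/

theorem lvlPis_rename (k : ℕ) (B : Term) (ξ : ℕ → ℕ) :
    (lvlPis k B).rename id ξ = lvlPis k (B.rename id (upRen^[k] ξ)) := by
  induction k generalizing ξ with
  | zero => rfl
  | succ k ih =>
    change Term.cpi _ ((lvlPis k B).rename id (upRen ξ)) = _
    rw [ih]; rfl

/-- `j₁ … jₖ. t` -/
def lvlLams : ℕ → Term → Term
  | 0, t => t
  | k + 1, t => .clam (lvlLams k t)

theorem lvlLams_rename (k : ℕ) (t : Term) (ξ : ℕ → ℕ) :
    (lvlLams k t).rename id ξ = lvlLams k (t.rename id (upRen^[k] ξ)) := by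
  induction k generalizing ξ with
  | zero => rfl
  | succ k ih =>
    change Term.clam ((lvlLams k t).rename id (upRen ξ)) = _
    rw [ih]; rfl

/-- The renaming of the variables `is` by the variables bound by `genPi is` and `genLam is`. -/
def genRen : List ℕ → ℕ → ℕ
  | [] => id
  | i :: is => fun n => upRen^[is.length] (captureRen i) (genRen is n)

theorem genPi_eq (is : List ℕ) (A : Term) :
    genPi is A = lvlPis is.length (A.rename id (genRen is)) := by
  induction is with
  | nil => simp [genPi, genRen, lvlPis, Term.rename_eq_subst]
  | cons i is ih =>
    change Term.cpi _ ((genPi is A).rename id (captureRen i)) = _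
    rw [ih, lvlPis_rename, Term.rename_rename]; rfl

theorem genLam_eq (is : List ℕ) (t : Term) :
    genLam is t = lvlLams is.length (t.rename id (genRen is)) := by
  induction is with
  | nil => simp [genLam, genRen, lvlLams, Term.rename_eq_subst]
  | cons i is ih =>
    change Term.clam ((genLam is t).rename id (captureRen i)) = _
    rw [ih, lvlLams_rename, Term.rename_rename]; rfl

theorem upRen_iterate (k : ℕ) (ξ : ℕ → ℕ) (n : ℕ) :
    upRen^[k] ξ n = if n < k then n else ξ (n - k) + k := by
  induction k generalizing ξ with
  | zero => simp
  | succ k ih =>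
    rw [Function.iterate_succ_apply, ih]
    rcases lt_trichotomy n k with h | rfl | h
    · rw [if_pos h, if_pos (by omega)]
    · simp [upRen]
    · obtain ⟨m, rfl⟩ := Nat.exists_eq_add_of_lt h
      rw [if_neg (by omega), if_neg (by omega), show k + m + 1 - k = m + 1 by omega,
        show k + m + 1 - (k + 1) = m by omega]
      simp [upRen]; omega

theorem genRen_of_notMem {is : List ℕ} {n : ℕ} (h : n ∉ is) : genRen is n = n + is.length := by
  induction is with
  | nil => rfl
  | cons i is ih =>
    simp only [List.mem_cons, not_or] at h
    simp [genRen, ih h.2, upRen_iterate, captureRen, h.1]; omega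

theorem genRen_lt {is : List ℕ} {n : ℕ} (h : n ∈ is) : genRen is n < is.length := by
  induction is with
  | nil => cases h
  | cons i is ih =>
    by_cases hn : n ∈ is
    · simp [genRen, upRen_iterate, ih hn]; have := ih hn; omega
    · obtain rfl := (List.mem_cons.1 h).resolve_right hn
      simp [genRen, upRen_iterate, genRen_of_notMem hn, captureRen]

theorem HasType.generalize_pi {k : ℕ} {Γ A s}
    (h : HasType Φ (List.replicate k (.conf Lvl) ++ Γ) A (.sort s)) (hΓ : WfCtx Φ Γ) :
    HasType Φ Γ (lvlPis k A) (.sort s) := by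
  induction k generalizing Γ with
  | zero => exact h
  | succ k ih =>
    rw [List.replicate_succ', List.append_assoc] at h
    exact .cpi (.lvl hΓ) (ih h (.conf (.lvl hΓ)))

theorem HasType.generalize_lam {k : ℕ} {Γ A t s}
    (hA : HasType Φ (List.replicate k (.conf Lvl) ++ Γ) A (.sort s))
    (ht : HasType Φ (List.replicate k (.conf Lvl) ++ Γ) t A) (hΓ : WfCtx Φ Γ) :
    HasType Φ Γ (lvlLams k t) (lvlPis k A) := by
  induction k generalizing Γ with
  | zero => exact ht
  | succ k ih =>
    rw [List.replicate_succ', List.append_assoc] at hA ht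
    have h := WfCtx.conf (.lvl hΓ)
    exact .clam (.lvl hΓ) (hA.generalize_pi h) (ih hA ht h)

theorem wfCtx_replicate (k : ℕ) : WfCtx Φ (List.replicate k (.conf Lvl)) := by
  induction k with
  | zero => exact .nil
  | succ k ih => exact .conf (.lvl ih)

theorem clookup_replicate {i k : ℕ} (h : i < k) :
    CLookup (List.replicate k (.conf Lvl)) i Lvl := by
  induction k generalizing i with
  | zero => omega
  | succ k ih =>
    cases i with
    | zero => exact .here
    | succ i => exact .conf (ih (by omega))

/-- The substitution of the variables `is` by the variables bound by `genPi is` and `genLam is`,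
and of the other variables by `0`. -/
def genSubst (is : List ℕ) : LevelSubst := fun n => if n ∈ is then .var (genRen is n) else .zero

theorem hasCType_subst_genSubst (is : List ℕ) (l : Level) :
    HasCType Φ (List.replicate is.length (.conf Lvl)) (l.subst (genSubst is)) Lvl := by
  induction l with
  | var i =>
    rw [Level.subst, genSubst]
    split_ifs with h
    · exact .var (wfCtx_replicate _) (clookup_replicate (genRen_lt h))
    · exact .zero (wfCtx_replicate _)
  | zero => exact .zero (wfCtx_replicate _)
  | succ l ih => exact .succ ih
  | max l l' ih ih' => exact .max ih ih'

theorem Term.lsubst_lsubst (t : Term) (θ θ' : LevelSubst) :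
    (t.lsubst θ).lsubst θ' = t.lsubst fun i => (θ i).subst θ' :=
  subst_subst _ _ _ _ _

theorem genPi_lsubst {A : Term} {is : List ℕ} (h : Enumerates is A.lfv) :
    genPi is A = lvlPis is.length (A.lsubst (genSubst is)) := by
  rw [genPi_eq, Term.rename_eq_subst]
  refine congrArg _ (Term.lsubst_congr_lfv fun i hi => ?_)
  rw [genSubst, if_pos ((h.2 i).2 hi)]

theorem genLam_lsubst {A t : Term} {is : List ℕ} (h : Enumerates is A.lfv) :
    genLam is (t.lsubst (zeroOn (t.lfv \ A.lfv))) =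
      lvlLams is.length (t.lsubst (genSubst is)) := by
  rw [genLam_eq, Term.rename_eq_subst]
  refine congrArg _ ((Term.lsubst_lsubst _ _ _).trans (Term.lsubst_congr_lfv fun i hi => ?_))
  by_cases hA : i ∈ A.lfv
  · simp [genSubst, zeroOn, hA, (h.2 i).2 hA, Level.subst]
  · simp [genSubst, zeroOn, hA, (h.2 i).not.2 hA, hi, Level.subst]

theorem Unifies.comp {θ : LevelSubst} {C : Problem} (h : Unifies θ C) (θ' : LevelSubst) :
    Unifies (fun i => (θ i).subst θ') C := fun p hp => by
  rw [← Level.subst_subst, ← Level.subst_subst]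
  exact (h p hp).subst fun _ => .refl _

theorem CtxInst.genSubst (θ : LevelSubst) (is : List ℕ) :
    CtxInst Φ (fun i => (θ i).subst (genSubst is)) []
      (List.replicate is.length (.conf Lvl)) where
  wf := wfCtx_replicate _
  lookup := nofun
  level _ := hasCType_subst_genSubst _ _

end

end UPP

theorem mainTheorem4 (Φ : UPP.LocalSig) (hΦ : UPP.WfSig Φ) (c : ℕ) (hc : UPP.Fresh c Φ)
    (A t : UPP.Term) (hA : UPP.Schematic A) (ht : UPP.Schematic t) :
    (∀ (C₁ C₂ : UPP.Problem) (θ : UPP.LevelSubst) (is : List ℕ),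
      UPP.Check Φ [] ∅ A (.sort .type) C₁ →
      UPP.Check Φ [] C₁ t A C₂ →
      UPP.Unifies θ (C₁ ∪ C₂) →
      UPP.Enumerates is (A.lsubst θ).lfv →
      UPP.WfSig
        (⟨c, UPP.genPi is (A.lsubst θ),
          some (UPP.genLam is
            ((t.lsubst θ).lsubst (UPP.zeroOn ((t.lsubst θ).lfv \ (A.lsubst θ).lfv))))⟩ :: Φ)) ∧
    (∀ (C₁ : UPP.Problem) (θ : UPP.LevelSubst) (is : List ℕ),
      UPP.Check Φ [] ∅ A (.sort .type) C₁ →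
      UPP.Unifies θ C₁ →
      UPP.Enumerates is (A.lsubst θ).lfv →
      UPP.WfSig (⟨c, UPP.genPi is (A.lsubst θ), none⟩ :: Φ)) := by
  have hok := hΦ.sigOk
  have htype : ∀ {C₁ : UPP.Problem} {θ : UPP.LevelSubst} (is : List ℕ),
      UPP.Check Φ [] ∅ A (.sort .type) C₁ → UPP.Unifies θ C₁ →
      UPP.HasType Φ (List.replicate is.length (.conf UPP.Lvl) ++ [])
        ((A.lsubst θ).lsubst (UPP.genSubst is)) (.sort .type) := by
    intro C₁ θ is h hθ
    rw [UPP.Term.lsubst_lsubst, List.append_nil]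
    exact h.sound hok (.genSubst θ is) (hθ.comp _) (.sort (UPP.wfCtx_replicate _))
  refine ⟨fun C₁ C₂ θ is h₁ h₂ hθ his => .defn hΦ hc ?_, fun C₁ θ is h₁ hθ his => .decl (s := .type) hΦ hc ?_⟩
  · have h := htype is h₁ fun p hp => hθ p (.inl hp)
    rw [UPP.genPi_lsubst his, UPP.genLam_lsubst his]
    refine h.generalize_lam ?_ .nil
    rw [UPP.Term.lsubst_lsubst, List.append_nil] at h ⊢
    rw [UPP.Term.lsubst_lsubst]
    exact h₂.sound hok (.genSubst θ is)
      (UPP.Unifies.comp (fun p hp => hθ p (.inr hp)) _) h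
  · rw [UPP.genPi_lsubst his]
    exact (htype is h₁ hθ).generalize_pi .nil
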